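/- Let $m\ge n\ge 0$ be integers, $k\in\mathbb{C}$, $\alpha_1=k+n$, $\alpha_2=k+m$. For $1\le i\le m+n$ put $\mathrm{col}(i)=1$, $\mathrm{row}(i)=i$ if $i\le m$, and $\mathrm{col}(i)=2$, $\mathrm{row}(i)=i-n$ if $i>m$. For $m-n<i\le m$ put $\hat i=i+n$. Let $\mathfrak b=\bigoplus_{\mathrm{col}(i)\ge \mathrm{col}(j)}\mathbb{C}e_{i,j}\subset\mathfrak{gl}(m+n)$, with the invariant form $$\kappa(e_{i,j},e_{p,q})=\begin{cases}\alpha_1\delta_{i,q}\delta_{p,j}+\delta_{i,j}\delta_{p,q}&\text{if } i,j,p,q\le m,\\ \alpha_2\delta_{i,q}\delta_{p,j}+\delta_{i,j}\delta_{p,q}&\text{if } i,j,p,q>m,\\ 0&\text{otherwise.}\end{cases}$$ Let $V^\kappa(\mathfrak b)$ be the universal affine vertex algebra of $(\mathfrak b,\kappa)$, with vacuum $|0\rangle$, translation operator $\partial$ and products $u_{(s)}v$, where $u(z)=\sum_{s\in\mathbb Z}u_{(s)}z^{-s-1}$. Write $x[-s]=xt^{-s}|0\rangle$ for $x\in\mathfrak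 b$, $s\ge1$. The $W$-algebra $\mathcal W^k(\mathfrak{gl}(m+n),f)$, $f$ nilpotent of Jordan type $(2^n,1^{m-n})$, is realized as a vertex subalgebra of $V^\kappa(\mathfrak b)$. Consider the following elements of $V^\kappa(\mathfrak b)$: $$W^{(1)}_{p,q}=\sum_{\substack{1\le h,l\le m+n\\ \mathrm{row}(h)=p,\ \mathrm{row}(l)=q,\ \mathrm{col}(h)=\mathrm{col}(l)}}e_{h,l}[-1]\qquad(1\le p\le m-n,\ 1\le q\le m,\ \text{ or } m-n<p,q\le m),$$ $$W^{(2)}_{i,j}=e_{\hat i,j}[-1]-\alpha_2e_{i,j}[-2]+\sum_{m-n<u\le m}(e_{u,j}[-1])_{(-1)}e_{\hat i,\hat u}[-1]-\sum_{1\le u\le m-n}(e_{u,j}[-1])_{(-1)}e_{i,u}[-1]\qquad(m-n<i\le m,\ 1\le j\le m).$$ For a condition $P$ let $\delta(P)$ be $1$ if $P$ holds and $0$ otherwise. **Theorem.** For all $p,q$ and $i,j$ in the ranges above, $$\begin{aligned}(W^{(1)}_{p,q})_{(0)}W^{(2)}_{i,j}={}&-\delta_{p,j}W^{(2)}_{i,q}+\delta_{i,q}\,\delta(p>m-n)W^{(2)}_{p,j}-\delta_{i,q}\,\delta(p\le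 m-n)\sum_{w\le m-n}(W^{(1)}_{w,j})_{(-1)}W^{(1)}_{p,w}\\&-\delta_{i,q}\,\delta(p\le m-n)\,\alpha_2\,\partial W^{(1)}_{p,j}+\delta(p\le m-n,\ q>m-n)\,(W^{(1)}_{p,j})_{(-1)}W^{(1)}_{i,q},\end{aligned}$$ $$\begin{aligned}(W^{(1)}_{p,q})_{(1)}W^{(2)}_{i,j}={}&\delta_{p,j}\,\alpha_1\,\delta(q>m-n)W^{(1)}_{i,q}-\delta_{i,q}\,\delta(p\le m-n)(\alpha_2+\alpha_1)W^{(1)}_{p,j}+\delta_{p,q}\,\delta(j>m-n)W^{(1)}_{i,j}\\&-\delta_{i,j}\,\delta(q\le m-n)W^{(1)}_{p,q}+\delta_{p,j}\delta_{q,i}\sum_{w\le m-n}W^{(1)}_{w,w},\end{aligned}$$ $$(W^{(1)}_{p,q})_{(2)}W^{(2)}_{i,j}=-\Bigl(\delta_{q,i}\delta_{p,j}(\alpha_1+\alpha_2)\alpha_1+\delta_{p,q}\delta_{i,j}\bigl(\delta(p\le m-n,\ q\le m-n)\,\alpha_1+2\alpha_2\bigr)\Bigr)|0\rangle,$$ $$(W^{(1)}_{p,q})_{(s)}W^{(2)}_{i,j}=0\qquad\text{for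 all integers } s>2.$$ (Terms with coefficient $0$ are omitted, so only $W^{(1)}$ and $W^{(2)}$ with indices in the stated ranges occur.) -/

import Mathlib

open scoped TensorProduct
open LieAlgebra

/-- A symmetric invariant bilinear form on a complex Lie algebra. -/
structure InvariantForm (g : Type*) [LieRing g] [LieAlgebra ℂ g] where
  form : LinearMap.BilinForm ℂ g
  symm : form.IsSymm
  invariant : form.lieInvariant g

attribute [local instance 100] LieRing.ofAssociativeRing

noncomputable section

namespace AffineVertex

variable {g : Type*} [LieRing g] [LieAlgebra ℂ g] (κ : InvariantForm g)

/-- The 2-cocycle `(x t^a, y t^b) ↦ a δ_{a+b,0} κ(x, y)` on the loop algebra `g[t, t⁻¹]`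
(Mathlib's residue pairing is `(f, g) ↦ Res (f dg)`, whence the sign). -/
def cocycle : LieModule.Cohomology.twoCocycle ℂ (loopAlgebra ℂ ℤ g)
    (TrivialLieModule ℂ (loopAlgebra ℂ ℤ g) ℂ) :=
  LoopAlgebra.twoCocycleOfBilinear ℂ ℤ g (-κ.form)
    (fun x y z => by simpa using congrArg Neg.neg (κ.invariant x y z))
    ⟨fun x y => by simpa using κ.symm.eq x y⟩

/-- The affine Lie algebra `g[t, t⁻¹] ⊕ ℂ K` of `g` and `κ`. -/
abbrev Affine : Type _ := LieAlgebra.ofTwoCocycle (cocycle κ)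

/-- The element `x t^n` of the affine Lie algebra. -/
def loop (x : g) (n : ℤ) : Affine κ :=
  ofProd (cocycle κ) (AddMonoidAlgebra.single n 1 ⊗ₜ[ℂ] x, 0)

/-- The central element `K` of the affine Lie algebra. -/
def central : Affine κ :=
  ofProd (cocycle κ) (0, (TrivialLieModule.equiv ℂ (loopAlgebra ℂ ℤ g) ℂ).symm 1)

theorem loop_lie_loop (x y : g) (a b : ℤ) :
    ⁅loop κ x a, loop κ y b⁆ =
      loop κ ⁅x, y⁆ (a + b) + (if a + b = 0 then (a : ℂ) * κ.form x y else 0) • central κ := by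
  rw [bracket_ofTwoCocycle]
  simp only [loop, central, ← of_smul, ← of_add, Equiv.symm_apply_apply, Prod.mk_add_mk,
    Prod.smul_mk]
  have h1 : ⁅(AddMonoidAlgebra.single a (1 : ℂ) ⊗ₜ[ℂ] x : loopAlgebra ℂ ℤ g),
      (AddMonoidAlgebra.single b (1 : ℂ) ⊗ₜ[ℂ] y : loopAlgebra ℂ ℤ g)⁆ =
      AddMonoidAlgebra.single (a + b) (1 : ℂ) ⊗ₜ[ℂ] ⁅x, y⁆ := by
    rw [LieAlgebra.ExtendScalars.bracket_tmul, AddMonoidAlgebra.single_mul_single, mul_one]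
  have h2 : ((cocycle κ : LieModule.Cohomology.twoCochain ℂ (loopAlgebra ℂ ℤ g)
      (TrivialLieModule ℂ (loopAlgebra ℂ ℤ g) ℂ)) :
        loopAlgebra ℂ ℤ g →ₗ[ℂ] loopAlgebra ℂ ℤ g →ₗ[ℂ]
          TrivialLieModule ℂ (loopAlgebra ℂ ℤ g) ℂ)
      (AddMonoidAlgebra.single a (1 : ℂ) ⊗ₜ[ℂ] x) (AddMonoidAlgebra.single b (1 : ℂ) ⊗ₜ[ℂ] y) =
      (TrivialLieModule.equiv ℂ (loopAlgebra ℂ ℤ g) ℂ).symm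
        (if a + b = 0 then (a : ℂ) * κ.form x y else 0) := by
    change (TrivialLieModule.equiv ℂ (loopAlgebra ℂ ℤ g) ℂ).symm
      (LoopAlgebra.residuePairing ℂ ℤ g (-κ.form) _ _) = _
    congr 1
    rw [LoopAlgebra.residuePairing_apply_apply, LoopAlgebra.toFinsupp_single_tmul,
      LoopAlgebra.toFinsupp_single_tmul, Finsupp.sum_single_index (by simp)]
    by_cases h : a + b = 0
    · obtain rfl : b = -a := by omega
      simp
    · have : a ≠ -b := by omega
      simp [h, this]
  rw [h1]
  congr 2
  rw [h2]
  simp [← map_smul]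

theorem central_lie (z : Affine κ) : ⁅central κ, z⁆ = 0 := by
  rw [bracket_ofTwoCocycle]
  simp only [central, Equiv.symm_apply_apply, zero_lie, map_zero, LinearMap.zero_apply,
    LieModule.IsTrivial.trivial, sub_zero, add_zero]
  exact of_zero _

theorem ι_smul (c : ℂ) (z : Affine κ) :
    UniversalEnvelopingAlgebra.ι ℂ (c • z) = c • UniversalEnvelopingAlgebra.ι ℂ z :=
  (UniversalEnvelopingAlgebra.ι ℂ).toLinearMap.map_smul c z

theorem affine_induction {P : Affine κ → Prop} (hadd : ∀ a b, P a → P b → P (a + b))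
    (hloop : ∀ x n, P (loop κ x n)) (hc : ∀ c : ℂ, P (c • central κ)) (z : Affine κ) : P z := by
  obtain ⟨⟨f, c⟩, rfl⟩ := (ofProd (cocycle κ)).surjective z
  have h0 : P 0 := by simpa using hc 0
  have : (ofProd (cocycle κ)) (f, c) = ofProd (cocycle κ) (f, 0)
      + (TrivialLieModule.equiv ℂ (loopAlgebra ℂ ℤ g) ℂ c) • central κ := by
    simp only [central, ← of_smul, ← of_add, Prod.mk_add_mk, Prod.smul_mk, ← map_smul]
    simp
  rw [this]
  refine hadd _ _ ?_ (hc _)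
  clear this
  induction f using TensorProduct.induction_on with
  | zero => exact h0
  | add a b ha hb =>
    have := hadd _ _ ha hb
    simpa [← of_add] using this
  | tmul p x =>
    induction p using AddMonoidAlgebra.induction_linear with
    | zero => rw [TensorProduct.zero_tmul]; exact h0
    | add a b ha hb =>
      have := hadd _ _ ha hb
      simpa [← of_add, TensorProduct.add_tmul] using this
    | single n r =>
      have := hloop (r • x) n
      rwa [loop, ← TensorProduct.smul_tmul, AddMonoidAlgebra.smul_single, smul_eq_mul,
        mul_one] at this

abbrev UAffine : Type _ := UniversalEnvelopingAlgebra ℂ (Affine κ)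

/-- The left ideal of `U(ĝ)` generated by `g[t]` and `K - 1`. -/
def vacuumIdeal : Submodule (UAffine κ) (UAffine κ) :=
  Submodule.span (UAffine κ)
    ({u | ∃ (x : g) (n : ℤ), 0 ≤ n ∧ u = UniversalEnvelopingAlgebra.ι ℂ (loop κ x n)} ∪
      {UniversalEnvelopingAlgebra.ι ℂ (central κ) - 1})

/-- The vacuum module `U(ĝ) ⊗_{U(g[t] ⊕ ℂ K)} ℂ`, where `g[t]` acts on `ℂ` by zero and `K` by `1`. -/
def VacuumModule : Type _ := UAffine κ ⧸ vacuumIdeal κ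

instance : AddCommGroup (VacuumModule κ) := inferInstanceAs (AddCommGroup (UAffine κ ⧸ vacuumIdeal κ))

instance : Module (UAffine κ) (VacuumModule κ) :=
  inferInstanceAs (Module (UAffine κ) (UAffine κ ⧸ vacuumIdeal κ))

instance : Module ℂ (VacuumModule κ) := inferInstanceAs (Module ℂ (UAffine κ ⧸ vacuumIdeal κ))

instance : IsScalarTower ℂ (UAffine κ) (VacuumModule κ) :=
  inferInstanceAs (IsScalarTower ℂ (UAffine κ) (UAffine κ ⧸ vacuumIdeal κ))

/-- The projection `U(ĝ) → U(ĝ) / (left ideal)`. -/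
def toVacuumModule : UAffine κ →ₗ[UAffine κ] VacuumModule κ := (vacuumIdeal κ).mkQ

theorem toVacuumModule_surjective : Function.Surjective (toVacuumModule κ) :=
  (vacuumIdeal κ).mkQ_surjective

theorem toVacuumModule_eq_zero {u : UAffine κ} (hu : u ∈ vacuumIdeal κ) :
    toVacuumModule κ u = 0 :=
  (Submodule.Quotient.mk_eq_zero _).2 hu

/-- The vacuum vector `|0⟩`. -/
def vacuum : VacuumModule κ := toVacuumModule κ 1

/-- The operator by which `x t^n` acts on the vacuum module. -/
def mode (x : g) (n : ℤ) : Module.End ℂ (VacuumModule κ) :=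
  Algebra.lsmul ℂ ℂ (VacuumModule κ) (UniversalEnvelopingAlgebra.ι ℂ (loop κ x n))

theorem loop_add (x y : g) (n : ℤ) : loop κ (x + y) n = loop κ x n + loop κ y n := by
  simp [loop, ← of_add, TensorProduct.tmul_add]

theorem loop_smul (c : ℂ) (x : g) (n : ℤ) : loop κ (c • x) n = c • loop κ x n := by
  simp [loop, ← of_smul, TensorProduct.tmul_smul]

theorem mode_vacuum (x : g) (n : ℤ) (hn : 0 ≤ n) : mode κ x n (vacuum κ) = 0 := by
  change UniversalEnvelopingAlgebra.ι ℂ (loop κ x n) • toVacuumModule κ 1 = 0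
  rw [← map_smul, smul_eq_mul, mul_one]
  exact toVacuumModule_eq_zero κ (Submodule.subset_span (Or.inl ⟨x, n, hn, rfl⟩))

theorem central_commute (u : UAffine κ) :
    u * UniversalEnvelopingAlgebra.ι ℂ (central κ) =
      UniversalEnvelopingAlgebra.ι ℂ (central κ) * u := by
  obtain ⟨t, rfl⟩ : ∃ t, UniversalEnvelopingAlgebra.mkAlgHom ℂ (Affine κ) t = u :=
    RingCon.mkₐ_surjective _ u
  induction t using TensorAlgebra.induction with
  | algebraMap r => rw [AlgHom.commutes]; exact Algebra.commutes _ _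
  | ι x => 
    have h := congrArg (UniversalEnvelopingAlgebra.ι ℂ) (central_lie κ x)
    rw [LieHom.map_lie, map_zero, LieRing.of_associative_ring_bracket, sub_eq_zero] at h
    exact h.symm
  | mul a b ha hb => rw [map_mul, mul_assoc, hb, ← mul_assoc, ha, mul_assoc]
  | add a b ha hb => rw [map_add, add_mul, mul_add, ha, hb]

theorem central_smul (v : VacuumModule κ) :
    UniversalEnvelopingAlgebra.ι ℂ (central κ) • v = v := by
  obtain ⟨u, rfl⟩ := toVacuumModule_surjective κ v
  rw [← sub_eq_zero, ← map_smul, ← map_sub, smul_eq_mul, ← central_commute]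
  refine toVacuumModule_eq_zero κ ?_
  have := (vacuumIdeal κ).smul_mem u (Submodule.subset_span
    (Or.inr (Set.mem_singleton (UniversalEnvelopingAlgebra.ι ℂ (central κ) - 1))))
  simpa [mul_sub] using this

theorem mode_comm (x y : g) (a b : ℤ) (v : VacuumModule κ) :
    mode κ x a (mode κ y b v) = mode κ y b (mode κ x a v) + mode κ ⁅x, y⁆ (a + b) v
      + (if a + b = 0 then (a : ℂ) * κ.form x y else 0) • v := by
  have h := congrArg (UniversalEnvelopingAlgebra.ι ℂ) (loop_lie_loop κ x y a b)
  rw [LieHom.map_lie, LieRing.of_associative_ring_bracket, sub_eq_iff_eq_add, map_add,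
    ι_smul] at h
  simp only [mode, Algebra.lsmul_coe, ← mul_smul, h, add_smul, smul_assoc, central_smul]
  abel

theorem mode_eventually_zero (v : VacuumModule κ) (x : g) :
    ∃ N : ℤ, ∀ n ≥ N, mode κ x n v = 0 := by
  obtain ⟨u, rfl⟩ := toVacuumModule_surjective κ v
  obtain ⟨t, rfl⟩ : ∃ t, UniversalEnvelopingAlgebra.mkAlgHom ℂ (Affine κ) t = u :=
    RingCon.mkₐ_surjective _ u
  have key : ∀ t (v : VacuumModule κ), (∀ x, ∃ N : ℤ, ∀ n ≥ N, mode κ x n v = 0) →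
      ∀ x, ∃ N : ℤ, ∀ n ≥ N,
        mode κ x n (UniversalEnvelopingAlgebra.mkAlgHom ℂ (Affine κ) t • v) = 0 := by
    intro t
    induction t using TensorAlgebra.induction with
    | algebraMap r =>
      intro v hv x
      obtain ⟨N, hN⟩ := hv x
      refine ⟨N, fun n hn => ?_⟩
      rw [AlgHom.commutes, algebraMap_smul, map_smul, hN n hn, smul_zero]
    | mul a b ha hb =>
      intro v hv
      simpa [mul_smul] using ha _ (hb v hv)
    | add a b ha hb =>
      intro v hv x
      obtain ⟨N, hN⟩ := ha v hv x
      obtain ⟨M, hM⟩ := hb v hv x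
      refine ⟨max N M, fun n hn => ?_⟩
      rw [map_add, add_smul, map_add, hN n (le_trans (le_max_left _ _) hn),
        hM n (le_trans (le_max_right _ _) hn), add_zero]
    | ι z =>
      intro v hv
      change ∀ x, ∃ N : ℤ, ∀ n ≥ N, mode κ x n (UniversalEnvelopingAlgebra.ι ℂ z • v) = 0
      induction z using affine_induction with
      | hadd a b ha hb =>
        intro x
        obtain ⟨N, hN⟩ := ha x
        obtain ⟨M, hM⟩ := hb x
        refine ⟨max N M, fun n hn => ?_⟩
        rw [map_add, add_smul, map_add, hN n (le_trans (le_max_left _ _) hn),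
          hM n (le_trans (le_max_right _ _) hn), add_zero]
      | hc c =>
        intro x
        obtain ⟨N, hN⟩ := hv x
        refine ⟨N, fun n hn => ?_⟩
        rw [ι_smul, smul_assoc, central_smul, map_smul, hN n hn, smul_zero]
      | hloop y k =>
        intro x
        obtain ⟨N, hN⟩ := hv x
        obtain ⟨M, hM⟩ := hv ⁅x, y⁆
        refine ⟨max N (max (M - k) (1 - k)), fun n hn => ?_⟩
        simp only [ge_iff_le, max_le_iff] at hn
        change mode κ x n (mode κ y k v) = 0
        rw [mode_comm, hN n hn.1, hM _ (by omega), if_neg (by omega)]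
        simp
  have := key t (vacuum κ) (fun x => ⟨0, fun n hn => mode_vacuum κ x n hn⟩) x
  rwa [vacuum, ← map_smul, smul_eq_mul, mul_one] at this


/-! ### Fields on the vacuum module and the state-field correspondence -/

open Finset

/-- The binomial coefficient `(-1)^j (m choose j)`. -/
def binom (m : ℤ) (j : ℕ) : ℤ := (-1) ^ j * Ring.choose m j

theorem binom_add (m k : ℤ) (s : ℕ) :
    ∑ p ∈ antidiagonal s, binom m p.1 * binom k p.2 = binom (m + k) s := by
  rw [binom, Ring.add_choose_eq s (Commute.all m k), mul_sum]
  refine sum_congr rfl fun p hp => ?_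
  rw [← mem_antidiagonal.1 hp, binom, binom, pow_add]
  ring

theorem binom_mul_sub (m : ℤ) (i : ℕ) : binom m i * (m - i) = m * binom (m - 1) i := by
  have h1 := Ring.choose_add_smul_choose (m - 1) i 1
  have h2 := Ring.choose_smul_choose m (n := i + 1) (k := i) (by omega)
  simp only [sub_add_cancel, Ring.choose_one_right, Nat.cast_one, Nat.choose_one_right,
    add_tsub_cancel_left, Nat.choose_succ_self_right] at h1 h2
  rw [binom, binom, mul_assoc, ← h2, h1]
  ring

theorem binom_central (m k : ℤ) (s : ℕ) (hs : m + k = s) :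
    ∑ p ∈ antidiagonal s, binom m p.1 * binom k p.2 * (m - p.1) = if s = 0 then m else 0 := by
  have : ∀ p ∈ antidiagonal s, binom m p.1 * binom k p.2 * (m - p.1) =
      m * (binom (m - 1) p.1 * binom k p.2) := fun p _ => by
    linear_combination binom k p.2 * binom_mul_sub m p.1
  rw [sum_congr rfl this, ← mul_sum, binom_add]
  rcases s with _ | s
  · simp [binom]
  · rw [show m - 1 + k = (s : ℤ) by push_cast at hs; omega, binom, Ring.choose_natCast,
      Nat.choose_succ_self]
    simp

section FiniteSums

variable {M : Type*} [AddCommGroup M]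

theorem finsum_range (f : ℕ → M) (N : ℕ) (h : ∀ j, N ≤ j → f j = 0) :
    ∑ᶠ j, f j = ∑ j ∈ range N, f j :=
  finsum_eq_sum_of_support_subset _ fun j hj => by
    simp only [coe_range, Set.mem_Iio]
    by_contra hc
    exact hj (h j (not_lt.1 hc))

theorem finsum_add_of (f f' : ℕ → M) (N : ℕ) (h : ∀ j, N ≤ j → f j = 0)
    (h' : ∀ j, N ≤ j → f' j = 0) : ∑ᶠ j, (f j + f' j) = ∑ᶠ j, f j + ∑ᶠ j, f' j := by
  rw [finsum_range f N h, finsum_range f' N h', ← sum_add_distrib]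
  exact finsum_range _ N fun j hj => by rw [h j hj, h' j hj, add_zero]

theorem map_finsum_of {M' : Type*} [AddCommGroup M'] (φ : M →+ M') (f : ℕ → M) (N : ℕ)
    (h : ∀ j, N ≤ j → f j = 0) : φ (∑ᶠ j, f j) = ∑ᶠ j, φ (f j) := by
  rw [finsum_range f N h, map_sum]
  exact (finsum_range _ N fun j hj => by rw [h j hj, map_zero]).symm

theorem finsum_antidiagonal (G : ℕ → ℕ → M) (N : ℕ) (h : ∀ i j, N ≤ i + j → G i j = 0) :
    ∑ᶠ i, ∑ᶠ j, G i j = ∑ s ∈ range N, ∑ p ∈ antidiagonal s, G p.1 p.2 := by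
  have h1 : ∀ i, ∑ᶠ j, G i j = ∑ j ∈ range N, G i j := fun i =>
    finsum_range _ N fun j hj => h i j (by omega)
  simp only [h1]
  rw [finsum_range _ N fun i hi => sum_eq_zero fun j _ => h i j (by omega), ← sum_product']
  rw [← sum_filter_add_sum_filter_not (range N ×ˢ range N) (fun p => p.1 + p.2 < N)]
  rw [sum_eq_zero (s := filter (fun p : ℕ × ℕ => ¬ p.1 + p.2 < N) _)
    (f := fun p => G p.1 p.2) (fun p hp => h _ _ (not_lt.1 (mem_filter.1 hp).2)), add_zero]
  rw [← sum_fiberwise_of_maps_to (t := range N) (g := fun p : ℕ × ℕ => p.1 + p.2)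
    (fun p hp => mem_range.2 (mem_filter.1 hp).2)]
  refine sum_congr rfl fun s hs => sum_congr ?_ fun _ _ => rfl
  ext p
  simp only [mem_filter, mem_product, mem_range, HasAntidiagonal.mem_antidiagonal] at hs ⊢
  omega

theorem finsum_antidiagonal_swap (G : ℕ → ℕ → M) (N : ℕ) (h : ∀ i j, N ≤ i + j → G i j = 0) :
    ∑ᶠ j, ∑ᶠ i, G i j = ∑ s ∈ range N, ∑ p ∈ antidiagonal s, G p.1 p.2 := by
  rw [finsum_antidiagonal (fun j i => G i j) N fun i j hij => h j i (by omega)]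
  refine sum_congr rfl fun s _ => ?_
  exact Nat.sum_antidiagonal_swap (f := fun p => G p.1 p.2)

end FiniteSums

/-- The space of fields on the vacuum module. -/
def Field : Type _ := VertexOperator ℂ (VacuumModule κ)

instance : AddCommGroup (Field κ) :=
  inferInstanceAs (AddCommGroup (VertexOperator ℂ (VacuumModule κ)))

instance : Module ℂ (Field κ) := inferInstanceAs (Module ℂ (VertexOperator ℂ (VacuumModule κ)))

/-- The modes `A_(n)` of a field `A(z) = ∑ A_(n) z^(-n-1)`. -/
def modes : Field κ →ₗ[ℂ] ℤ → Module.End ℂ (VacuumModule κ) :=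
  (VertexOperator.ncoeff : VertexOperator ℂ (VacuumModule κ) →ₗ[ℂ] _)

theorem field_eventually_zero (A : Field κ) (v : VacuumModule κ) :
    ∃ N : ℤ, ∀ n ≥ N, modes κ A n v = 0 :=
  ⟨-HahnSeries.order ((HahnModule.of ℂ).symm ((show VertexOperator ℂ (VacuumModule κ) from A) v)),
    fun n hn => VertexOperator.ncoeff_eq_zero_of_lt_order
      (show VertexOperator ℂ (VacuumModule κ) from A) n v (by omega)⟩

/-- The field `∑ f(n) z^(-n-1)` with prescribed modes. -/
def fieldOfModes (f : ℤ → Module.End ℂ (VacuumModule κ))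
    (hf : ∀ v, ∃ N : ℤ, ∀ n ≥ N, f n v = 0) : Field κ :=
  (VertexOperator.of_coeff (fun n => f (-n - 1)) fun v => by
    obtain ⟨N, hN⟩ := hf v
    refine ⟨-N, fun n hn => ?_⟩
    by_contra hc
    exact hn (hN _ (by omega)) : VertexOperator ℂ (VacuumModule κ))

theorem modes_fieldOfModes (f : ℤ → Module.End ℂ (VacuumModule κ))
    (hf : ∀ v, ∃ N : ℤ, ∀ n ≥ N, f n v = 0) (n : ℤ) : modes κ (fieldOfModes κ f hf) n = f n := by
  refine (VertexOperator.ncoeff_of_coeff _ _ n).trans ?_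
  congr 1
  omega

theorem field_ext {A B : Field κ} (h : ∀ n v, modes κ A n v = modes κ B n v) : A = B := by
  refine HVertexOperator.coeff_inj (funext fun n => LinearMap.ext fun v => ?_)
  have h' := h (-n - 1) v
  change HVertexOperator.coeff (show VertexOperator ℂ (VacuumModule κ) from A) (-(-n - 1) - 1) v =
    HVertexOperator.coeff (show VertexOperator ℂ (VacuumModule κ) from B) (-(-n - 1) - 1) v at h'
  rwa [show -(-n - 1) - 1 = n by ring] at h'

/-- The identity field. -/
def idField : Field κ :=
  fieldOfModes κ (fun n => if n = -1 then 1 else 0) fun v =>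
    ⟨0, fun n hn => by rw [if_neg (by omega), LinearMap.zero_apply]⟩

theorem left_zero (x : g) (m : ℤ) (A : Field κ) (v : VacuumModule κ) :
    ∃ N : ℤ, ∀ (n : ℤ) (j : ℕ), N ≤ n + j →
      binom m j • mode κ x (m - j) (modes κ A (n + j) v) = 0 := by
  obtain ⟨N, hN⟩ := field_eventually_zero κ A v
  exact ⟨N, fun n j h => by rw [hN _ h, map_zero, smul_zero]⟩

theorem mode_nat_zero (x : g) (v : VacuumModule κ) :
    ∃ J : ℕ, ∀ j : ℕ, J ≤ j → mode κ x j v = 0 := by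
  obtain ⟨N, hN⟩ := mode_eventually_zero κ v x
  exact ⟨N.toNat, fun j hj => hN j (by omega)⟩

theorem right_zero (x : g) (A : Field κ) (v : VacuumModule κ) :
    ∃ N : ℤ, ∀ (n : ℤ) (j : ℕ), N ≤ n → modes κ A (n - j) (mode κ x j v) = 0 := by
  obtain ⟨J, hJ⟩ := mode_nat_zero κ x v
  have : ∀ K : ℕ, ∃ N : ℤ, ∀ (n : ℤ) (j : ℕ), j < K → N ≤ n → modes κ A (n - j) (mode κ x j v) = 0 := by
    intro K
    induction K with
    | zero => exact ⟨0, fun _ _ h => absurd h (by omega)⟩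
    | succ K ih =>
      obtain ⟨N, hN⟩ := ih
      obtain ⟨N', hN'⟩ := field_eventually_zero κ A (mode κ x K v)
      refine ⟨max N (N' + K), fun n j hj hn => ?_⟩
      rcases Nat.lt_succ_iff_lt_or_eq.1 hj with h | rfl
      · exact hN n j h (by omega)
      · exact hN' _ (by omega)
  obtain ⟨N, hN⟩ := this J
  refine ⟨N, fun n j hn => ?_⟩
  by_cases h : j < J
  · exact hN n j h hn
  · rw [hJ j (by omega), map_zero]

/-- The `n`-th mode of the part
`∑_{j ≥ 0} (-1)^j (m choose j) x_(m-j) A_(n+j)` of the `m`-th residue product of the current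
`x(z)` with the field `A(z)`. -/
def leftMode (x : g) (m : ℤ) (A : Field κ) (n : ℤ) :
    Module.End ℂ (VacuumModule κ) where
  toFun v := ∑ᶠ j : ℕ, binom m j • mode κ x (m - j) (modes κ A (n + j) v)
  map_add' v w := by
    obtain ⟨N, hN⟩ := left_zero κ x m A v
    obtain ⟨N', hN'⟩ := left_zero κ x m A w
    rw [← finsum_add_of _ _ (max (N - n) (N' - n)).toNat (fun j hj => hN n j (by omega))
      (fun j hj => hN' n j (by omega))]
    simp only [map_add, smul_add]
  map_smul' c v := by
    obtain ⟨N, hN⟩ := left_zero κ x m A v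
    have := map_finsum_of (DistribSMul.toAddMonoidHom _ c) _ _
      (fun (j : ℕ) (hj : (N - n).toNat ≤ j) => hN n j (by omega))
    simp only [DistribSMul.toAddMonoidHom_apply] at this
    rw [RingHom.id_apply, this]
    simp only [map_smul, smul_comm c]

/-- The `n`-th mode of the part
`-∑_{j ≥ 0} (-1)^(m+j) (m choose j) A_(m+n-j) x_(j)` of the `m`-th residue product of the current
`x(z)` with the field `A(z)`. -/
def rightMode (x : g) (m : ℤ) (A : Field κ) (n : ℤ) :
    Module.End ℂ (VacuumModule κ) where
  toFun v := ∑ᶠ j : ℕ, (-(m.negOnePow : ℤ) * binom m j) • modes κ A (m + n - j) (mode κ x j v)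
  map_add' v w := by
    obtain ⟨J, hJ⟩ := mode_nat_zero κ x v
    obtain ⟨J', hJ'⟩ := mode_nat_zero κ x w
    rw [← finsum_add_of _ _ (max J J') (fun j hj => by rw [hJ j (by omega), map_zero, smul_zero])
      (fun j hj => by rw [hJ' j (by omega), map_zero, smul_zero])]
    simp only [map_add, smul_add]
  map_smul' c v := by
    obtain ⟨J, hJ⟩ := mode_nat_zero κ x v
    have := map_finsum_of (DistribSMul.toAddMonoidHom _ c)
      (fun j : ℕ => (-(m.negOnePow : ℤ) * binom m j) • modes κ A (m + n - j) (mode κ x j v)) J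
      (fun j hj => by rw [hJ j hj, map_zero, smul_zero])
    simp only [DistribSMul.toAddMonoidHom_apply] at this
    rw [RingHom.id_apply, this]
    simp only [map_smul, smul_comm c]

def leftField (x : g) (m : ℤ) (A : Field κ) :
    Field κ :=
  fieldOfModes κ (leftMode κ x m A) fun v => by
    obtain ⟨N, hN⟩ := left_zero κ x m A v
    exact ⟨N, fun n hn => finsum_eq_zero_of_forall_eq_zero fun j => hN n j (by omega)⟩

def rightField (x : g) (m : ℤ) (A : Field κ) :
    Field κ :=
  fieldOfModes κ (rightMode κ x m A) fun v => by
    obtain ⟨N, hN⟩ := right_zero κ x A v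
    exact ⟨N - m, fun n hn => finsum_eq_zero_of_forall_eq_zero fun j => by
      rw [hN (m + n) j (by omega), smul_zero]⟩

theorem leftField_apply (x : g) (m : ℤ) (A : Field κ) (n : ℤ)
    (v : VacuumModule κ) : modes κ (leftField κ x m A) n v =
      ∑ᶠ j : ℕ, binom m j • mode κ x (m - j) (modes κ A (n + j) v) := by
  rw [leftField, modes_fieldOfModes]; rfl

theorem rightField_apply (x : g) (m : ℤ) (A : Field κ) (n : ℤ)
    (v : VacuumModule κ) : modes κ (rightField κ x m A) n v =
      ∑ᶠ j : ℕ, (-(m.negOnePow : ℤ) * binom m j) • modes κ A (m + n - j) (mode κ x j v) := by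
  rw [rightField, modes_fieldOfModes]; rfl

theorem mode_add (x y : g) (n : ℤ) : mode κ (x + y) n = mode κ x n + mode κ y n := by
  rw [mode, loop_add, map_add, map_add]; rfl

theorem mode_smul (c : ℂ) (x : g) (n : ℤ) : mode κ (c • x) n = c • mode κ x n := by
  rw [mode, loop_smul, ι_smul, map_smul]; rfl

theorem finsum_smul_of {M : Type*} [AddCommGroup M] [Module ℂ M] (c : ℂ) (f : ℕ → M) (N : ℕ)
    (h : ∀ j, N ≤ j → f j = 0) : ∑ᶠ j, c • f j = c • ∑ᶠ j, f j :=
  (map_finsum_of (DistribSMul.toAddMonoidHom _ c) f N h).symm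

theorem leftField_add (x y : g) (m : ℤ) (A : Field κ) :
    leftField κ (x + y) m A = leftField κ x m A + leftField κ y m A := by
  refine field_ext κ fun n v => ?_
  obtain ⟨N, hN⟩ := left_zero κ x m A v
  obtain ⟨N', hN'⟩ := left_zero κ y m A v
  rw [map_add, Pi.add_apply, LinearMap.add_apply]
  simp only [leftField_apply]
  rw [← finsum_add_of _ _ (max (N - n) (N' - n)).toNat (fun j hj => hN n j (by omega))
      (fun j hj => hN' n j (by omega))]
  simp only [mode_add, LinearMap.add_apply, smul_add]

theorem rightField_add (x y : g) (m : ℤ) (A : Field κ) :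
    rightField κ (x + y) m A = rightField κ x m A + rightField κ y m A := by
  refine field_ext κ fun n v => ?_
  obtain ⟨J, hJ⟩ := mode_nat_zero κ x v
  obtain ⟨J', hJ'⟩ := mode_nat_zero κ y v
  rw [map_add, Pi.add_apply, LinearMap.add_apply]
  simp only [rightField_apply]
  rw [← finsum_add_of _ _ (max J J') (fun j hj => by rw [hJ j (by omega), map_zero, smul_zero])
    (fun j hj => by rw [hJ' j (by omega), map_zero, smul_zero])]
  simp only [mode_add, LinearMap.add_apply, map_add, smul_add]

theorem leftField_smul (c : ℂ) (x : g) (m : ℤ) (A : Field κ) :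
    leftField κ (c • x) m A = c • leftField κ x m A := by
  refine field_ext κ fun n v => ?_
  obtain ⟨N, hN⟩ := left_zero κ x m A v
  rw [map_smul, Pi.smul_apply, LinearMap.smul_apply]
  simp only [leftField_apply]
  rw [← finsum_smul_of c _ (N - n).toNat (fun j hj => hN n j (by omega))]
  simp only [mode_smul, LinearMap.smul_apply, smul_comm c]

theorem rightField_smul (c : ℂ) (x : g) (m : ℤ) (A : Field κ) :
    rightField κ (c • x) m A = c • rightField κ x m A := by
  refine field_ext κ fun n v => ?_
  obtain ⟨J, hJ⟩ := mode_nat_zero κ x v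
  rw [map_smul, Pi.smul_apply, LinearMap.smul_apply]
  simp only [rightField_apply]
  rw [← finsum_smul_of c _ J (fun j hj => by rw [hJ j (by omega), map_zero, smul_zero])]
  simp only [mode_smul, LinearMap.smul_apply, map_smul, smul_comm c]

theorem leftField_add' (x : g) (m : ℤ) (A B : Field κ) :
    leftField κ x m (A + B) = leftField κ x m A + leftField κ x m B := by
  refine field_ext κ fun n v => ?_
  obtain ⟨N, hN⟩ := left_zero κ x m A v
  obtain ⟨N', hN'⟩ := left_zero κ x m B v
  rw [map_add, Pi.add_apply, LinearMap.add_apply]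
  simp only [leftField_apply]
  rw [← finsum_add_of _ _ (max (N - n) (N' - n)).toNat (fun j hj => hN n j (by omega))
      (fun j hj => hN' n j (by omega))]
  simp only [map_add, Pi.add_apply, LinearMap.add_apply, smul_add]

theorem rightField_add' (x : g) (m : ℤ) (A B : Field κ) :
    rightField κ x m (A + B) = rightField κ x m A + rightField κ x m B := by
  refine field_ext κ fun n v => ?_
  obtain ⟨J, hJ⟩ := mode_nat_zero κ x v
  rw [map_add, Pi.add_apply, LinearMap.add_apply]
  simp only [rightField_apply]
  rw [← finsum_add_of _ _ J (fun j hj => by rw [hJ j (by omega), map_zero, smul_zero])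
    (fun j hj => by rw [hJ j (by omega), map_zero, smul_zero])]
  simp only [map_add, Pi.add_apply, LinearMap.add_apply, smul_add]

theorem leftField_smul' (c : ℂ) (x : g) (m : ℤ) (A : Field κ) :
    leftField κ x m (c • A) = c • leftField κ x m A := by
  refine field_ext κ fun n v => ?_
  obtain ⟨N, hN⟩ := left_zero κ x m A v
  rw [map_smul, Pi.smul_apply, LinearMap.smul_apply]
  simp only [leftField_apply]
  rw [← finsum_smul_of c _ (N - n).toNat (fun j hj => hN n j (by omega))]
  simp only [map_smul, Pi.smul_apply, LinearMap.smul_apply, smul_comm c]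

theorem rightField_smul' (c : ℂ) (x : g) (m : ℤ) (A : Field κ) :
    rightField κ x m (c • A) = c • rightField κ x m A := by
  refine field_ext κ fun n v => ?_
  obtain ⟨J, hJ⟩ := mode_nat_zero κ x v
  rw [map_smul, Pi.smul_apply, LinearMap.smul_apply]
  simp only [rightField_apply]
  rw [← finsum_smul_of c _ J (fun j hj => by rw [hJ j (by omega), map_zero, smul_zero])]
  simp only [map_smul, Pi.smul_apply, LinearMap.smul_apply, smul_comm c]

/-- The `m`-th residue product `x(z)_(m) A(z)` of the current `x(z)` with a field `A(z)`, with modes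
`∑_{j ≥ 0} (-1)^j (m choose j) (x_(m-j) A_(n+j) - (-1)^m A_(m+n-j) x_(j))`. -/
def residueProduct (m : ℤ) :
    g →ₗ[ℂ] Module.End ℂ (Field κ) :=
  LinearMap.mk₂ ℂ (fun x A => leftField κ x m A + rightField κ x m A)
    (fun x y A => by rw [leftField_add, rightField_add]; abel)
    (fun c x A => by rw [leftField_smul, rightField_smul, smul_add])
    (fun x A B => by rw [leftField_add', rightField_add']; abel)
    (fun c x A => by rw [leftField_smul', rightField_smul', smul_add])

theorem mode_sum_comm (x y : g) (m k : ℤ) (s : ℕ) (w : VacuumModule κ) :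
    ∑ p ∈ antidiagonal s, (binom m p.1 * binom k p.2) •
        mode κ x (m - p.1) (mode κ y (k - p.2) w) =
      ∑ p ∈ antidiagonal s, (binom m p.1 * binom k p.2) •
        mode κ y (k - p.2) (mode κ x (m - p.1) w) +
      (binom (m + k) s • mode κ ⁅x, y⁆ (m + k - s) w +
        (if s = 0 then if m + k = 0 then (m : ℂ) * κ.form x y else 0 else 0) • w) := by
  have h1 : ∀ p ∈ antidiagonal s, (binom m p.1 * binom k p.2) •
      mode κ x (m - p.1) (mode κ y (k - p.2) w) =
      (binom m p.1 * binom k p.2) • mode κ y (k - p.2) (mode κ x (m - p.1) w) +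
      ((binom m p.1 * binom k p.2) • mode κ ⁅x, y⁆ (m + k - s) w +
        ((if m + k = s then ((binom m p.1 * binom k p.2 * (m - p.1) : ℤ) : ℂ) else 0)
          * κ.form x y) • w) := by
    intro p hp
    have hp' := HasAntidiagonal.mem_antidiagonal.1 hp
    rw [mode_comm, show m - (p.1 : ℤ) + (k - p.2) = m + k - s by omega, add_assoc, smul_add,
      smul_add]
    congr 2
    rw [← Int.cast_smul_eq_zsmul ℂ, smul_smul]
    congr 1
    by_cases h : m + k = s
    · rw [if_pos (by omega), if_pos h]
      push_cast
      ring
    · rw [if_neg (by omega), if_neg h]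
      ring
  rw [sum_congr rfl h1, sum_add_distrib, sum_add_distrib, ← sum_smul, ← sum_smul, binom_add,
    ← sum_mul]
  congr 3
  by_cases h : m + k = s
  · simp only [if_pos h]
    rw [← Int.cast_sum, binom_central m k s h]
    by_cases hs : s = 0
    · subst hs
      simp [h]
    · simp [hs]
  · simp only [if_neg h, sum_const_zero, zero_mul]
    by_cases hs : s = 0
    · subst hs
      have h' : ¬ m + k = 0 := by simpa using h
      simp [h']
    · simp [hs]

theorem left_left (x y : g) (m k : ℤ) (A : Field κ) :
    leftField κ x m (leftField κ y k A) = leftField κ y k (leftField κ x m A) +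
      (leftField κ ⁅x, y⁆ (m + k) A +
        (if m + k = 0 then (m : ℂ) * κ.form x y else 0) • A) := by
  refine field_ext κ fun n v => ?_
  obtain ⟨N₀, hN₀⟩ := field_eventually_zero κ A v
  obtain ⟨N, hN⟩ : ∃ N : ℕ, N₀ ≤ n + N ∧ 0 < N := ⟨(N₀ - n).toNat + 1, by omega, by omega⟩
  have hA : ∀ s : ℤ, N ≤ s → modes κ A (n + s) v = 0 := fun s hs => hN₀ _ (by omega)
  have e1 : modes κ (leftField κ x m (leftField κ y k A)) n v =
      ∑ s ∈ range N, ∑ p ∈ antidiagonal s, (binom m p.1 * binom k p.2) •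
        mode κ x (m - p.1) (mode κ y (k - p.2) (modes κ A (n + (p.1 + p.2 : ℕ)) v)) := by
    rw [← finsum_antidiagonal (fun i j => (binom m i * binom k j) •
        mode κ x (m - i) (mode κ y (k - j) (modes κ A (n + (i + j : ℕ)) v))) N
      (fun i j h => by rw [hA _ (by exact_mod_cast h), map_zero, map_zero, smul_zero])]
    rw [leftField_apply]
    refine finsum_congr fun i => ?_
    rw [leftField_apply]
    have := map_finsum_of ((binom m i • mode κ x (m - i)).toAddMonoidHom)
      (fun j : ℕ => binom k j • mode κ y (k - j) (modes κ A (n + i + j) v)) N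
      (fun j hj => by rw [add_assoc, hA _ (by omega), map_zero, smul_zero])
    refine this.trans (finsum_congr fun j => ?_)
    simp [mul_smul, add_assoc, map_zsmul, smul_comm (binom k j)]
  have e2 : modes κ (leftField κ y k (leftField κ x m A)) n v =
      ∑ s ∈ range N, ∑ p ∈ antidiagonal s, (binom m p.1 * binom k p.2) •
        mode κ y (k - p.2) (mode κ x (m - p.1) (modes κ A (n + (p.1 + p.2 : ℕ)) v)) := by
    rw [← finsum_antidiagonal_swap (fun i j => (binom m i * binom k j) •
        mode κ y (k - j) (mode κ x (m - i) (modes κ A (n + (i + j : ℕ)) v))) N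
      (fun i j h => by rw [hA _ (by exact_mod_cast h), map_zero, map_zero, smul_zero])]
    rw [leftField_apply]
    refine finsum_congr fun j => ?_
    rw [leftField_apply]
    have := map_finsum_of ((binom k j • mode κ y (k - j)).toAddMonoidHom)
      (fun i : ℕ => binom m i • mode κ x (m - i) (modes κ A (n + j + i) v)) N
      (fun i hi => by rw [add_assoc, hA _ (by omega), map_zero, smul_zero])
    refine this.trans (finsum_congr fun i => ?_)
    simp [mul_smul, add_assoc, map_zsmul, add_comm (i : ℤ), smul_comm (binom m i)]
  have e3 : modes κ (leftField κ ⁅x, y⁆ (m + k) A) n v =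
      ∑ s ∈ range N, binom (m + k) s • mode κ ⁅x, y⁆ (m + k - s) (modes κ A (n + s) v) := by
    rw [leftField_apply]
    exact finsum_range _ N fun s hs => by rw [hA _ (by omega), map_zero, smul_zero]
  have e4 : ∀ c : ℂ, c • modes κ A n v =
      ∑ s ∈ range N, (if s = 0 then c else 0) • modes κ A (n + (s : ℕ)) v := by
    intro c
    rw [sum_eq_single_of_mem 0 (mem_range.2 hN.2) (fun s _ hs => by rw [if_neg hs, zero_smul])]
    simp
  simp only [map_add, map_smul, Pi.add_apply, Pi.smul_apply, LinearMap.add_apply,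
    LinearMap.smul_apply]
  rw [e1, e2, e3, e4, ← sum_add_distrib, ← sum_add_distrib]
  refine sum_congr rfl fun s _ => ?_
  refine Eq.trans ?_ ((mode_sum_comm κ x y m k s (modes κ A (n + s) v)).trans ?_)
  · exact sum_congr rfl fun p hp => by rw [HasAntidiagonal.mem_antidiagonal.1 hp]
  · congr 1
    exact sum_congr rfl fun p hp => by rw [HasAntidiagonal.mem_antidiagonal.1 hp]

theorem zsmul_finsum_of (c : ℤ) (f : ℕ → VacuumModule κ) (N : ℕ)
    (h : ∀ j, N ≤ j → f j = 0) : c • ∑ᶠ j, f j = ∑ᶠ j, c • f j :=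
  map_finsum_of (zsmulAddGroupHom c) f N h

theorem left_right (x y : g) (m k : ℤ) (A : Field κ) :
    leftField κ x m (rightField κ y k A) = rightField κ y k (leftField κ x m A) := by
  refine field_ext κ fun n v => ?_
  obtain ⟨J, hJ⟩ := mode_nat_zero κ y v
  obtain ⟨N₀, hN₀⟩ := right_zero κ y A v
  obtain ⟨I, hI⟩ : ∃ I : ℕ, N₀ ≤ k + n + I := ⟨(N₀ - (k + n)).toNat, by omega⟩
  have hA : ∀ i j : ℕ, I ≤ i → modes κ A (k + (n + i) - j) (mode κ y j v) = 0 :=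
    fun i j h => hN₀ _ _ (by omega)
  have hG : ∀ i j : ℕ, I + J ≤ i + j → (binom m i * (-(k.negOnePow : ℤ) * binom k j)) •
      mode κ x (m - i) (modes κ A (k + (n + i) - j) (mode κ y j v)) = 0 := by
    intro i j h
    by_cases hi : I ≤ i
    · rw [hA i j hi, map_zero, smul_zero]
    · rw [hJ j (by omega), map_zero, map_zero, smul_zero]
  rw [leftField_apply, rightField_apply]
  trans ∑ᶠ i : ℕ, ∑ᶠ j : ℕ, (binom m i * (-(k.negOnePow : ℤ) * binom k j)) •
      mode κ x (m - i) (modes κ A (k + (n + i) - j) (mode κ y j v))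
  · refine finsum_congr fun i => ?_
    rw [rightField_apply]
    have := map_finsum_of ((binom m i • mode κ x (m - i)).toAddMonoidHom)
      (fun j : ℕ => (-(k.negOnePow : ℤ) * binom k j) •
        modes κ A (k + (n + i) - j) (mode κ y j v)) J
      (fun j hj => by rw [hJ j hj, map_zero, smul_zero])
    refine this.trans (finsum_congr fun j => ?_)
    simp [mul_smul, map_zsmul]
  · rw [finsum_antidiagonal _ _ hG, ← finsum_antidiagonal_swap _ _ hG]
    refine finsum_congr fun j => ?_
    rw [leftField_apply]
    have := zsmul_finsum_of κ (-(k.negOnePow : ℤ) * binom k j)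
      (fun i : ℕ => binom m i • mode κ x (m - i) (modes κ A (k + n - j + i) (mode κ y j v))) I
      (fun i hi => by
        rw [show k + n - (j : ℤ) + i = k + (n + i) - j by ring, hA i j hi, map_zero, smul_zero])
    refine Eq.trans ?_ this.symm
    refine finsum_congr fun i => ?_
    rw [show k + n - (j : ℤ) + i = k + (n + i) - j by ring]
    rw [mul_comm, mul_smul]

theorem right_right (x y : g) (m k : ℤ) (A : Field κ) :
    rightField κ x m (rightField κ y k A) = rightField κ y k (rightField κ x m A) +
      rightField κ ⁅x, y⁆ (m + k) A := by
  refine field_ext κ fun n v => ?_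
  have bound : ∀ x y : g, ∃ N : ℕ, ∀ i j : ℕ, N ≤ i + j → mode κ y j (mode κ x i v) = 0 := by
    intro x y
    obtain ⟨I, hI⟩ := mode_nat_zero κ x v
    have : ∀ K : ℕ, ∃ J : ℕ, ∀ i j : ℕ, i < K → J ≤ j → mode κ y j (mode κ x i v) = 0 := by
      intro K
      induction K with
      | zero => exact ⟨0, fun i j h => absurd h (by omega)⟩
      | succ K ih =>
        obtain ⟨J, hJ⟩ := ih
        obtain ⟨J', hJ'⟩ := mode_nat_zero κ y (mode κ x K v)
        refine ⟨max J J', fun i j hi hj => ?_⟩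
        rcases Nat.lt_succ_iff_lt_or_eq.1 hi with h | rfl
        · exact hJ i j h (by omega)
        · exact hJ' j (by omega)
    obtain ⟨J, hJ⟩ := this I
    refine ⟨I + J, fun i j h => ?_⟩
    by_cases hi : i < I
    · exact hJ i j hi (by omega)
    · rw [hI i (by omega), map_zero]
  obtain ⟨N₁, h₁⟩ := bound x y
  obtain ⟨N₂, h₂⟩ := bound y x
  obtain ⟨N₃, h₃⟩ := mode_nat_zero κ ⁅x, y⁆ v
  let N := max N₁ (max N₂ N₃)
  let ε : ℤ := (m.negOnePow : ℤ) * (k.negOnePow : ℤ)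
  have e1 : modes κ (rightField κ x m (rightField κ y k A)) n v =
      ∑ s ∈ range N, ∑ p ∈ antidiagonal s, (ε * (binom m p.1 * binom k p.2)) •
        modes κ A (m + k + n - (p.1 + p.2 : ℕ)) (mode κ y p.2 (mode κ x p.1 v)) := by
    rw [← finsum_antidiagonal (fun i j => (ε * (binom m i * binom k j)) •
        modes κ A (m + k + n - (i + j : ℕ)) (mode κ y j (mode κ x i v))) N
      (fun i j h => by rw [h₁ i j (by omega), map_zero, smul_zero])]
    rw [rightField_apply]
    refine finsum_congr fun i => ?_
    rw [rightField_apply]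
    have := zsmul_finsum_of κ (-(m.negOnePow : ℤ) * binom m i)
      (fun j : ℕ => (-(k.negOnePow : ℤ) * binom k j) •
        modes κ A (k + (m + n - i) - j) (mode κ y j (mode κ x i v))) N
      (fun j hj => by rw [h₁ i j (by omega), map_zero, smul_zero])
    refine this.trans (finsum_congr fun j => ?_)
    rw [← mul_smul, show k + (m + n - i) - (j : ℤ) = m + k + n - (i + j : ℕ) by push_cast; ring]
    congr 1
    simp only [ε]
    ring
  have e2 : modes κ (rightField κ y k (rightField κ x m A)) n v =
      ∑ s ∈ range N, ∑ p ∈ antidiagonal s, (ε * (binom m p.1 * binom k p.2)) •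
        modes κ A (m + k + n - (p.1 + p.2 : ℕ)) (mode κ x p.1 (mode κ y p.2 v)) := by
    rw [← finsum_antidiagonal_swap (fun i j => (ε * (binom m i * binom k j)) •
        modes κ A (m + k + n - (i + j : ℕ)) (mode κ x i (mode κ y j v))) N
      (fun i j h => by rw [h₂ j i (by omega), map_zero, smul_zero])]
    rw [rightField_apply]
    refine finsum_congr fun j => ?_
    rw [rightField_apply]
    have := zsmul_finsum_of κ (-(k.negOnePow : ℤ) * binom k j)
      (fun i : ℕ => (-(m.negOnePow : ℤ) * binom m i) •
        modes κ A (m + (k + n - j) - i) (mode κ x i (mode κ y j v))) N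
      (fun i hi => by rw [h₂ j i (by omega), map_zero, smul_zero])
    refine this.trans (finsum_congr fun i => ?_)
    rw [← mul_smul, show m + (k + n - j) - (i : ℤ) = m + k + n - (i + j : ℕ) by push_cast; ring]
    congr 1
    simp only [ε]
    ring
  have e3 : modes κ (rightField κ ⁅x, y⁆ (m + k) A) n v =
      ∑ s ∈ range N, (-ε * binom (m + k) s) •
        modes κ A (m + k + n - (s : ℕ)) (mode κ ⁅x, y⁆ s v) := by
    rw [rightField_apply, Int.negOnePow_add, Units.val_mul]
    exact finsum_range _ N fun s hs => by rw [h₃ s (by omega), map_zero, smul_zero]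
  rw [map_add, Pi.add_apply, LinearMap.add_apply, e1, e2, e3, ← sum_add_distrib]
  refine sum_congr rfl fun s _ => ?_
  rw [← binom_add, mul_sum, sum_smul, ← sum_add_distrib]
  refine sum_congr rfl fun p hp => ?_
  have hp' := HasAntidiagonal.mem_antidiagonal.1 hp
  have hc : (if (p.1 : ℤ) + p.2 = 0 then ((p.1 : ℤ) : ℂ) * κ.form x y else 0) = 0 := by
    split_ifs with h
    · rw [show p.1 = 0 by omega]
      simp
    · rfl
  rw [mode_comm κ x y, hc, zero_smul, add_zero, map_add, hp', smul_add,
    show (p.1 : ℤ) + p.2 = s by omega, neg_mul, neg_smul, add_neg_cancel_right]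

theorem residueProduct_lie (x y : g) (m k : ℤ) :
    ⁅residueProduct κ m x, residueProduct κ k y⁆ = residueProduct κ (m + k) ⁅x, y⁆ +
      (if m + k = 0 then (m : ℂ) * κ.form x y else 0) • (1 : Module.End ℂ _) := by
  refine LinearMap.ext fun A => ?_
  change leftField κ x m (leftField κ y k A + rightField κ y k A) +
      rightField κ x m (leftField κ y k A + rightField κ y k A) -
      (leftField κ y k (leftField κ x m A + rightField κ x m A) +
      rightField κ y k (leftField κ x m A + rightField κ x m A)) =
    leftField κ ⁅x, y⁆ (m + k) A + rightField κ ⁅x, y⁆ (m + k) A +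
      (if m + k = 0 then (m : ℂ) * κ.form x y else 0) • A
  simp only [leftField_add', rightField_add']
  rw [left_left, right_right, left_right, ← left_right κ y x k m]
  abel

theorem residueProduct_idField (x : g) (m : ℤ) (hm : 0 ≤ m) :
    residueProduct κ m x (idField κ) = 0 := by
  obtain ⟨m, rfl⟩ := Int.eq_ofNat_of_zero_le hm
  refine field_ext κ fun n v => ?_
  change modes κ (leftField κ x m (idField κ) + rightField κ x m (idField κ)) n v = _
  have hid : ∀ (n : ℤ) (v : VacuumModule κ), modes κ (idField κ) n v = if n = -1 then v else 0 := by
    intro n v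
    rw [idField, modes_fieldOfModes]
    split_ifs <;> rfl
  rw [map_add, Pi.add_apply, LinearMap.add_apply, leftField_apply, rightField_apply, map_zero,
    Pi.zero_apply, LinearMap.zero_apply]
  simp only [hid, binom, Ring.choose_natCast]
  by_cases h : ∃ i : ℕ, i ≤ m ∧ n = -1 - i
  · obtain ⟨i, hi, rfl⟩ := h
    rw [finsum_eq_single _ i fun j hj => by rw [if_neg (by omega), map_zero, smul_zero],
      finsum_eq_single _ (m - i) fun j hj => by rw [if_neg (by omega), smul_zero],
      if_pos (by omega), if_pos (by omega), Nat.choose_symm hi, Nat.cast_sub hi, ← add_smul]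
    convert zero_smul ℤ _
    have : ((-1 : ℤ) ^ m) = (-1) ^ i * (-1) ^ (m - i) := by rw [← pow_add]; congr 1; omega
    rw [Int.negOnePow_def, zpow_natCast, Units.val_pow_eq_pow_val, Units.val_neg, Units.val_one,
      this]
    have h2 : ((-1 : ℤ) ^ (m - i)) * (-1) ^ (m - i) = 1 := by
      rw [← mul_pow]; simp
    linear_combination (-(-1) ^ i * (m.choose i : ℤ)) * h2
  · rw [finsum_eq_zero_of_forall_eq_zero, finsum_eq_zero_of_forall_eq_zero, add_zero]
    · intro j
      by_cases hj : j ≤ m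
      · rw [if_neg (fun h' => h ⟨m - j, by omega, by omega⟩), smul_zero]
      · rw [Nat.choose_eq_zero_of_lt (by omega)]
        simp
    · intro j
      by_cases hj : j ≤ m
      · rw [if_neg (fun h' => h ⟨j, by omega, by omega⟩), map_zero, smul_zero]
      · rw [Nat.choose_eq_zero_of_lt (by omega)]
        simp

/-- The linear action of the affine Lie algebra on the space of fields: `x t^m` acts by
`x(z)_(m)` and `K` acts by `1`. -/
def fieldActionLinear : Affine κ →ₗ[ℂ] Module.End ℂ (Field κ) where
  toFun z :=
    Finsupp.lsum ℂ (residueProduct κ) (LoopAlgebra.toFinsupp ℂ ℤ g ((ofProd (cocycle κ)).symm z).1)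
      + TrivialLieModule.equiv ℂ (loopAlgebra ℂ ℤ g) ℂ ((ofProd (cocycle κ)).symm z).2 • 1
  map_add' z w := by
    change Finsupp.lsum ℂ (residueProduct κ) (LoopAlgebra.toFinsupp ℂ ℤ g
      (((ofProd (cocycle κ)).symm z).1 + ((ofProd (cocycle κ)).symm w).1)) +
      TrivialLieModule.equiv ℂ (loopAlgebra ℂ ℤ g) ℂ
        (((ofProd (cocycle κ)).symm z).2 + ((ofProd (cocycle κ)).symm w).2) • 1 = _
    simp only [map_add, add_smul]
    abel
  map_smul' c z := by
    change Finsupp.lsum ℂ (residueProduct κ) (LoopAlgebra.toFinsupp ℂ ℤ g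
      (c • ((ofProd (cocycle κ)).symm z).1)) +
      TrivialLieModule.equiv ℂ (loopAlgebra ℂ ℤ g) ℂ
        (c • ((ofProd (cocycle κ)).symm z).2) • 1 = _
    simp only [map_smul, smul_add, smul_assoc, RingHom.id_apply]

theorem fieldActionLinear_loop (x : g) (m : ℤ) :
    fieldActionLinear κ (loop κ x m) = residueProduct κ m x := by
  simp only [fieldActionLinear, loop, LinearMap.coe_mk, AddHom.coe_mk, Equiv.symm_apply_apply,
    LoopAlgebra.toFinsupp_single_tmul, Finsupp.lsum_single, map_zero, zero_smul, add_zero]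

theorem fieldActionLinear_central : fieldActionLinear κ (central κ) = 1 := by
  simp only [fieldActionLinear, central, LinearMap.coe_mk, AddHom.coe_mk, Equiv.symm_apply_apply,
    map_zero, zero_add, LinearEquiv.apply_symm_apply, one_smul]

theorem lie_of_loop {B : Type*} [Ring B] [Algebra ℂ B] (φ : Affine κ →ₗ[ℂ] B)
    (hc : φ (central κ) = 1)
    (hl : ∀ (x y : g) (m k : ℤ), φ (loop κ x m) * φ (loop κ y k) - φ (loop κ y k) * φ (loop κ x m)
      = φ (loop κ ⁅x, y⁆ (m + k)) + (if m + k = 0 then (m : ℂ) * κ.form x y else 0) • (1 : B))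
    (z w : Affine κ) : φ ⁅z, w⁆ = φ z * φ w - φ w * φ z := by
  induction z using affine_induction with
  | hadd a b ha hb => rw [add_lie, map_add, map_add, ha, hb, add_mul, mul_add]; abel
  | hc c =>
    rw [smul_lie, central_lie, smul_zero, map_zero, map_smul, hc,
      smul_mul_assoc, mul_smul_comm, one_mul, mul_one, sub_self]
  | hloop x m =>
    induction w using affine_induction with
    | hadd a b ha hb => rw [lie_add, map_add, map_add, ha, hb, add_mul, mul_add]; abel
    | hc c =>
      rw [lie_smul, ← lie_skew, central_lie, neg_zero, smul_zero, map_zero, map_smul,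
        hc, smul_mul_assoc, mul_smul_comm, one_mul, mul_one, sub_self]
    | hloop y k => rw [loop_lie_loop, map_add, map_smul, hc, hl]

theorem fieldActionLinear_lie (z w : Affine κ) :
    fieldActionLinear κ ⁅z, w⁆ =
      fieldActionLinear κ z * fieldActionLinear κ w -
        fieldActionLinear κ w * fieldActionLinear κ z :=
  lie_of_loop κ (fieldActionLinear κ) (fieldActionLinear_central κ) (fun x y m k => by
    rw [fieldActionLinear_loop, fieldActionLinear_loop, fieldActionLinear_loop]
    exact residueProduct_lie κ x y m k) z w

/-- The representation of the affine Lie algebra on the space of fields in which `x t^m` acts by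
the residue product `x(z)_(m)` and `K` acts by `1`. -/
def fieldAction : Affine κ →ₗ⁅ℂ⁆ Module.End ℂ (Field κ) :=
  { fieldActionLinear κ with map_lie' := fun {z w} => fieldActionLinear_lie κ z w }

/-- The action of `U(ĝ)` on the identity field. -/
def fieldOfU : UAffine κ →ₗ[ℂ] Field κ :=
  (LinearMap.applyₗ (idField κ)) ∘ₗ
    (UniversalEnvelopingAlgebra.lift ℂ (fieldAction κ)).toLinearMap

theorem fieldOfU_mul (a b : UAffine κ) : fieldOfU κ (a * b) =
    UniversalEnvelopingAlgebra.lift ℂ (fieldAction κ) a (fieldOfU κ b) := by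
  simp only [fieldOfU, LinearMap.comp_apply, AlgHom.toLinearMap_apply, map_mul]
  rfl

theorem fieldOfU_eq_zero (u : UAffine κ) (hu : u ∈ vacuumIdeal κ) : fieldOfU κ u = 0 := by
  induction hu using Submodule.span_induction with
  | zero => rw [map_zero]
  | add a b _ _ ha hb => rw [map_add, ha, hb, add_zero]
  | smul a b _ hb => rw [smul_eq_mul, fieldOfU_mul, hb, map_zero]
  | mem u hu =>
    rcases hu with ⟨x, n, hn, rfl⟩ | rfl
    · change UniversalEnvelopingAlgebra.lift ℂ (fieldAction κ) _ (idField κ) = 0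
      rw [UniversalEnvelopingAlgebra.lift_ι_apply]
      change fieldActionLinear κ (loop κ x n) (idField κ) = 0
      rw [fieldActionLinear_loop, residueProduct_idField κ x n hn]
    · change UniversalEnvelopingAlgebra.lift ℂ (fieldAction κ) _ (idField κ) = 0
      have h : UniversalEnvelopingAlgebra.lift ℂ (fieldAction κ)
          (UniversalEnvelopingAlgebra.ι ℂ (central κ) - 1) = 0 := by
        rw [map_sub, UniversalEnvelopingAlgebra.lift_ι_apply, map_one, sub_eq_zero]
        exact fieldActionLinear_central κ
      rw [h, LinearMap.zero_apply]

/-- The state-field correspondence of the universal affine vertex algebra: the linear map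
`a ↦ Y(a, z)` determined by `Y(|0⟩, z) = id` and `Y(x_(m) a, z) = x(z)_(m) Y(a, z)`. -/
def stateField : VacuumModule κ →ₗ[ℂ] Field κ :=
  ((vacuumIdeal κ).restrictScalars ℂ).liftQ (fieldOfU κ) (fun u hu => fieldOfU_eq_zero κ u hu) ∘ₗ
    (Submodule.Quotient.restrictScalarsEquiv ℂ (vacuumIdeal κ)).symm.toLinearMap

/-- The vector `x[-s] = x t^(-s) |0⟩`. -/
def state (x : g) (s : ℕ) : VacuumModule κ := mode κ x (-s) (vacuum κ)

/-- The `s`-th product `a_(s) b` of the universal affine vertex algebra. -/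
def VacuumModule.nthProduct {κ : InvariantForm g} (a : VacuumModule κ) (s : ℤ)
    (b : VacuumModule κ) : VacuumModule κ :=
  modes κ (stateField κ a) s b

/-- The translation operator `∂ a = a_(-2) |0⟩`. -/
def VacuumModule.translation {κ : InvariantForm g} (a : VacuumModule κ) : VacuumModule κ :=
  a.nthProduct (-2) (vacuum κ)

end AffineVertex

namespace WAlgebraGL

open AffineVertex

variable (m n : ℕ)

/-! Indices are counted from `0`: the indices `1, …, m + n` of `gl(m + n)` are `Fin (m + n)`, and the
rows `1, …, m` are `Fin m`; the condition `i > m - n` becomes `m - n ≤ i`. -/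

/-- The column `1` or `2` of the index `i`. -/
def col (i : Fin (m + n)) : ℕ := if (i : ℕ) < m then 1 else 2

/-- The row of the index `i`. -/
def row (i : Fin (m + n)) : ℕ := if (i : ℕ) < m then i else i - n

/-- The index in the first column whose row is `i`. -/
def idx (i : Fin m) : Fin (m + n) := Fin.castAdd n i

/-- The index `î`: for a row `i > m - n`, the index in the second column whose row is `i`. -/
def hat (i : Fin m) : Fin (m + n) := Fin.addNat i n

/-- The Lie subalgebra `b` of `gl(m + n)` spanned by the `e_{i,j}` with `col i ≥ col j`. -/
def subalgB : LieSubalgebra ℂ (Matrix (Fin (m + n)) (Fin (m + n)) ℂ) where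
  carrier := {x | ∀ i j, col m n i < col m n j → x i j = 0}
  zero_mem' := fun _ _ _ => rfl
  add_mem' := fun hx hy i j h => by rw [Matrix.add_apply, hx i j h, hy i j h, add_zero]
  smul_mem' := fun c x hx i j h => by rw [Matrix.smul_apply, hx i j h, smul_zero]
  lie_mem' := by
    have key : ∀ x y : Matrix (Fin (m + n)) (Fin (m + n)) ℂ,
        (∀ i j, col m n i < col m n j → x i j = 0) → (∀ i j, col m n i < col m n j → y i j = 0) →
        ∀ i j, col m n i < col m n j → (x * y) i j = 0 := by
      intro x y hx hy i j h
      rw [Matrix.mul_apply]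
      refine Finset.sum_eq_zero fun r _ => ?_
      by_cases hr : col m n i < col m n r
      · rw [hx i r hr, zero_mul]
      · rw [hy r j (by omega), mul_zero]
    intro x y hx hy i j h
    rw [LieRing.of_associative_ring_bracket, Matrix.sub_apply, key x y hx hy i j h,
      key y x hy hx i j h, sub_zero]

/-- The matrix unit `e_{i,j}`, as an element of `b` (for `col i ≥ col j`). -/
def unit (i j : Fin (m + n)) : subalgB m n :=
  if h : col m n j ≤ col m n i then
    ⟨Matrix.single i j 1, fun a b hab => by
      rw [Matrix.single_apply, if_neg]
      rintro ⟨rfl, rfl⟩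
      omega⟩
  else 0

/-- The diagonal block of size `m`. -/
def block₁ (x : subalgB m n) : Matrix (Fin m) (Fin m) ℂ :=
  (x : Matrix (Fin (m + n)) (Fin (m + n)) ℂ).submatrix (Fin.castAdd n) (Fin.castAdd n)

/-- The diagonal block of size `n`. -/
def block₂ (x : subalgB m n) : Matrix (Fin n) (Fin n) ℂ :=
  (x : Matrix (Fin (m + n)) (Fin (m + n)) ℂ).submatrix (Fin.natAdd m) (Fin.natAdd m)

theorem block₁_lie (x y : subalgB m n) :
    block₁ m n ⁅x, y⁆ = block₁ m n x * block₁ m n y - block₁ m n y * block₁ m n x := by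
  have key : ∀ x y : subalgB m n, ∀ i j : Fin m,
      ((x : Matrix (Fin (m + n)) (Fin (m + n)) ℂ) * (y : Matrix (Fin (m + n)) (Fin (m + n)) ℂ))
        (Fin.castAdd n i) (Fin.castAdd n j) = (block₁ m n x * block₁ m n y) i j := by
    intro x y i j
    rw [Matrix.mul_apply, Matrix.mul_apply, Fin.sum_univ_add]
    simp only [block₁, Matrix.submatrix_apply]
    rw [add_eq_left]
    refine Finset.sum_eq_zero fun r _ => ?_
    rw [x.2 _ _ (by simp [col]), zero_mul]
  ext i j
  rw [Matrix.sub_apply, ← key, ← key]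
  rfl

theorem block₂_lie (x y : subalgB m n) :
    block₂ m n ⁅x, y⁆ = block₂ m n x * block₂ m n y - block₂ m n y * block₂ m n x := by
  have key : ∀ x y : subalgB m n, ∀ i j : Fin n,
      ((x : Matrix (Fin (m + n)) (Fin (m + n)) ℂ) * (y : Matrix (Fin (m + n)) (Fin (m + n)) ℂ))
        (Fin.natAdd m i) (Fin.natAdd m j) = (block₂ m n x * block₂ m n y) i j := by
    intro x y i j
    rw [Matrix.mul_apply, Matrix.mul_apply, Fin.sum_univ_add]
    simp only [block₂, Matrix.submatrix_apply]
    rw [add_eq_right]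
    refine Finset.sum_eq_zero fun r _ => ?_
    rw [y.2 _ _ (by simp [col]), mul_zero]
  ext i j
  rw [Matrix.sub_apply, ← key, ← key]
  rfl

/-- The level `α₁ = k + n`. -/
def alpha₁ (n : ℕ) (k : ℂ) : ℂ := k + n

/-- The level `α₂ = k + m`. -/
def alpha₂ (m : ℕ) (k : ℂ) : ℂ := k + m

/-- The invariant form `κ` on `b`: `κ(e_{i,j}, e_{p,q})` is `α₁ δ_{i,q} δ_{p,j} + δ_{i,j} δ_{p,q}`
if all four indices have column `1`, it is `α₂ δ_{i,q} δ_{p,j} + δ_{i,j} δ_{p,q}` if all four have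
column `2`, and it is `0` otherwise. -/
def kappa (k : ℂ) : InvariantForm (subalgB m n) where
  form := LinearMap.mk₂ ℂ
    (fun x y =>
      alpha₁ n k * (block₁ m n x * block₁ m n y).trace
        + (block₁ m n x).trace * (block₁ m n y).trace
        + (alpha₂ m k * (block₂ m n x * block₂ m n y).trace
        + (block₂ m n x).trace * (block₂ m n y).trace))
    (fun x x' y => by
      have h₁ : block₁ m n (x + x') = block₁ m n x + block₁ m n x' := rfl
      have h₂ : block₂ m n (x + x') = block₂ m n x + block₂ m n x' := rfl
      simp only [h₁, h₂, add_mul, Matrix.trace_add]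
      ring)
    (fun c x y => by
      have h₁ : block₁ m n (c • x) = c • block₁ m n x := rfl
      have h₂ : block₂ m n (c • x) = c • block₂ m n x := rfl
      simp only [h₁, h₂, smul_mul_assoc, Matrix.trace_smul, smul_eq_mul]
      ring)
    (fun x y y' => by
      have h₁ : block₁ m n (y + y') = block₁ m n y + block₁ m n y' := rfl
      have h₂ : block₂ m n (y + y') = block₂ m n y + block₂ m n y' := rfl
      simp only [h₁, h₂, mul_add, Matrix.trace_add]
      ring)
    (fun c x y => by
      have h₁ : block₁ m n (c • y) = c • block₁ m n y := rfl
      have h₂ : block₂ m n (c • y) = c • block₂ m n y := rfl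
      simp only [h₁, h₂, mul_smul_comm, Matrix.trace_smul, smul_eq_mul]
      ring)
  symm := ⟨fun x y => by
    simp only [LinearMap.mk₂_apply]
    rw [Matrix.trace_mul_comm (block₁ m n x), Matrix.trace_mul_comm (block₂ m n x)]
    ring⟩
  invariant := fun x y z => by
    simp only [LinearMap.mk₂_apply, block₁_lie, block₂_lie, sub_mul, mul_sub, Matrix.trace_sub]
    rw [Matrix.trace_mul_comm (block₁ m n x) (block₁ m n y),
      Matrix.trace_mul_comm (block₂ m n x) (block₂ m n y),
      Matrix.trace_mul_comm (block₁ m n x) (block₁ m n z),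
      Matrix.trace_mul_comm (block₂ m n x) (block₂ m n z),
      Matrix.mul_assoc (block₁ m n x), Matrix.trace_mul_comm (block₁ m n x),
      Matrix.mul_assoc (block₂ m n x), Matrix.trace_mul_comm (block₂ m n x)]
    simp only [Matrix.mul_assoc]
    ring

/-- The universal affine vertex algebra `V^κ(b)`. -/
abbrev VB (k : ℂ) : Type := VacuumModule (kappa m n k)

/-- The vector `e_{i,j}[-s]` of `V^κ(b)`. -/
def eState (k : ℂ) (i j : Fin (m + n)) (s : ℕ) : VB m n k := state (kappa m n k) (unit m n i j) s

/-- `W^{(1)}_{p,q}`, for `p ≤ m - n` or `p, q > m - n`. -/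
def W₁ (k : ℂ) (p q : Fin m) : VB m n k :=
  ∑ h : Fin (m + n), ∑ l : Fin (m + n),
    if row m n h = p ∧ row m n l = q ∧ col m n h = col m n l then eState m n k h l 1 else 0

/-- `W^{(2)}_{i,j}`, for `i > m - n`. -/
def W₂ (k : ℂ) (i j : Fin m) : VB m n k :=
  eState m n k (hat m n i) (idx m n j) 1
    - alpha₂ m k • eState m n k (idx m n i) (idx m n j) 2
    + ∑ u : Fin m with m - n ≤ u.val, (eState m n k (idx m n u) (idx m n j) 1).nthProduct (-1)
        (eState m n k (hat m n i) (hat m n u) 1)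
    - ∑ u : Fin m with u.val < m - n, (eState m n k (idx m n u) (idx m n j) 1).nthProduct (-1)
        (eState m n k (idx m n i) (idx m n u) 1)

/-- The indicator `δ(P)` of a condition. -/
def delta (P : Prop) [Decidable P] : ℂ := if P then 1 else 0

end WAlgebraGL

end

open AffineVertex WAlgebraGL

/-!
The field of `x[-1]` is the current `x(z)`, so the product `x[-1]_(s) v` is the action of the mode
`x t^s` on `v` (`nthProduct_state_one`): in `x(z)_(-1) id`, all binomial coefficients are `1` and
the two halves of the residue product supply the negative and the nonnegative modes. Since
`W^{(1)}_{p,q} = X[-1]` for an element `X` of `b` (`w₁`, `W₁_eq`), only the nonnegative modes of `X`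
have to be applied to `W^{(2)}_{i,j}`, a combination of vectors `y[-1]`, `y[-2]` and
`(y[-1])_(-1) z[-1]`. Commuting a mode through these vectors to the vacuum, which it annihilates,
gives derivations for `s = 0`, iterated brackets and values of the form for `s = 1`, multiples of
the vacuum for `s = 2`, and zero for `s > 2`.

What remains is the Lie algebra `b`, in terms of the matrix units `e₁₁`, `e₂₂`, `e₂₁` of its three
blocks. `X` acts on the first block as `e₁₁ p q`, whatever `p` and `q` are, and has a component in
the second block only for `p > m - n`. In the first and the second product, the sum over the `m - n` rows
`u ≤ m - n` in `W^{(2)}_{i,j}` leaves `m - n` equal terms, and `m - n = α₂ - α₁`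
(`alpha₂_sub_alpha₁`) turns them into the stated multiples of the levels.
-/

noncomputable section

namespace AffineVertex

variable {g : Type*} [LieRing g] [LieAlgebra ℂ g] (κ : InvariantForm g)

/-! ### Products with `x[-1]` and with quadratic vectors in an affine vertex algebra -/

theorem binom_neg_one (j : ℕ) : binom (-1) j = 1 := by
  rw [binom, Ring.choose_neg', Ring.multichoose_one, Units.smul_def, Int.coe_negOnePow_natCast,
    smul_eq_mul, mul_one, ← mul_pow, neg_one_mul, neg_neg, one_pow]

theorem modes_idField (n : ℤ) (v : VacuumModule κ) :
    modes κ (idField κ) n v = if n = -1 then v else 0 := by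
  rw [idField, modes_fieldOfModes]
  split_ifs <;> rfl

/-- The field attached to `x[-1]` is the current `x(z)`. -/
theorem modes_stateField_state_one (x : g) (s : ℤ) (v : VacuumModule κ) :
    modes κ (stateField κ (state κ x 1)) s v = mode κ x s v := by
  have h : stateField κ (state κ x 1) = leftField κ x (-1) (idField κ) +
      rightField κ x (-1) (idField κ) := by
    change fieldOfU κ (UniversalEnvelopingAlgebra.ι ℂ (loop κ x (-(1 : ℕ))) * 1) = _
    rw [fieldOfU_mul, UniversalEnvelopingAlgebra.lift_ι_apply]
    have h1 : fieldOfU κ 1 = idField κ := by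
      change UniversalEnvelopingAlgebra.lift ℂ (fieldAction κ) 1 (idField κ) = _
      rw [map_one]; rfl
    rw [h1]
    change fieldActionLinear κ (loop κ x (-1)) (idField κ) = _
    rw [fieldActionLinear_loop]
    rfl
  rw [h, map_add, Pi.add_apply, LinearMap.add_apply, leftField_apply, rightField_apply]
  simp only [binom_neg_one, modes_idField, one_smul, mul_one]
  rcases lt_or_ge s 0 with hs | hs
  · rw [finsum_eq_single _ (-1 - s).toNat fun j hj => by rw [if_neg (by omega), map_zero],
      finsum_eq_zero_of_forall_eq_zero fun j => by rw [if_neg (by omega), smul_zero],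
      if_pos (by omega), add_zero]
    congr 2
    omega
  · rw [finsum_eq_zero_of_forall_eq_zero fun j => by rw [if_neg (by omega), map_zero],
      finsum_eq_single _ s.toNat fun j hj => by rw [if_neg (by omega), smul_zero],
      if_pos (by omega), zero_add, Int.toNat_of_nonneg hs]
    simp

theorem nthProduct_state_one (x : g) (s : ℤ) (v : VacuumModule κ) :
    (state κ x 1).nthProduct s v = mode κ x s v :=
  modes_stateField_state_one κ x s v

theorem translation_state_one (x : g) : (state κ x 1).translation = state κ x 2 :=
  nthProduct_state_one κ x (-2) (vacuum κ)

/-- The linear map `x ↦ x[-s]`. -/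
def stateHom (s : ℕ) : g →ₗ[ℂ] VacuumModule κ where
  toFun x := state κ x s
  map_add' x y := by simp only [state, mode_add, LinearMap.add_apply]
  map_smul' c x := by simp only [state, mode_smul, LinearMap.smul_apply, RingHom.id_apply]

/-- The bilinear map `(y, z) ↦ (y[-1])_(-1) z[-1]`. -/
def quadHom : g →ₗ[ℂ] g →ₗ[ℂ] VacuumModule κ :=
  LinearMap.mk₂ ℂ (fun y z => mode κ y (-1) (stateHom κ 1 z))
    (fun x y z => by simp only [mode_add, LinearMap.add_apply])
    (fun c x z => by simp only [mode_smul, LinearMap.smul_apply])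
    (fun x y z => by simp only [map_add])
    (fun c x z => by simp only [map_smul])

theorem nthProduct_stateHom (x : g) (s : ℤ) (v : VacuumModule κ) :
    (stateHom κ 1 x).nthProduct s v = mode κ x s v :=
  nthProduct_state_one κ x s v

theorem translation_stateHom (x : g) : (stateHom κ 1 x).translation = stateHom κ 2 x :=
  translation_state_one κ x

theorem mode_neg_one_stateHom (y z : g) :
    mode κ y (-1) (stateHom κ 1 z) = quadHom κ y z := rfl

theorem nthProduct_stateHom_stateHom (y z : g) :
    (stateHom κ 1 y).nthProduct (-1) (stateHom κ 1 z) = quadHom κ y z :=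
  nthProduct_state_one κ y (-1) _

/-- The action of a nonnegative mode on `y[-t]`. -/
theorem mode_stateHom (x y : g) (s : ℤ) (hs : 0 ≤ s) (t : ℕ) :
    mode κ x s (stateHom κ t y) = mode κ ⁅x, y⁆ (s - t) (vacuum κ)
      + (if s = t then (s : ℂ) * κ.form x y else 0) • vacuum κ := by
  change mode κ x s (mode κ y (-t) (vacuum κ)) = _
  rw [mode_comm, mode_vacuum κ x s hs, map_zero, zero_add, ← sub_eq_add_neg]
  simp only [sub_eq_zero]

theorem mode_stateHom_eq_zero (x y : g) (s : ℤ) (t : ℕ) (h : t < s) :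
    mode κ x s (stateHom κ t y) = 0 := by
  rw [mode_stateHom κ x y s (by omega), mode_vacuum _ _ _ (by omega), if_neg (by omega),
    zero_smul, add_zero]

theorem mode_zero_stateHom (x y : g) (t : ℕ) (ht : t ≠ 0):
    mode κ x 0 (stateHom κ t y) = stateHom κ t ⁅x, y⁆ := by
  rw [mode_stateHom κ x y 0 le_rfl, if_neg (by omega), zero_smul, add_zero, zero_sub]
  rfl

theorem mode_one_stateHom_one (x y : g) :
    mode κ x 1 (stateHom κ 1 y) = κ.form x y • vacuum κ := by
  rw [mode_stateHom κ x y 1 zero_le_one, mode_vacuum _ _ _ (by simp)]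
  simp

theorem mode_one_stateHom_two (x y : g) :
    mode κ x 1 (stateHom κ 2 y) = stateHom κ 1 ⁅x, y⁆ := by
  rw [mode_stateHom κ x y 1 zero_le_one, if_neg (by omega), zero_smul, add_zero]
  rfl

theorem mode_two_stateHom_two (x y : g) :
    mode κ x 2 (stateHom κ 2 y) = (2 * κ.form x y) • vacuum κ := by
  rw [mode_stateHom κ x y 2 zero_le_two, mode_vacuum _ _ _ (by simp)]
  simp

theorem mode_quadHom (x y z : g) (s : ℤ) :
    mode κ x s (quadHom κ y z) = mode κ y (-1) (mode κ x s (stateHom κ 1 z))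
      + mode κ ⁅x, y⁆ (s - 1) (stateHom κ 1 z)
      + (if s = 1 then κ.form x y else 0) • stateHom κ 1 z := by
  change mode κ x s (mode κ y (-1) (stateHom κ 1 z)) = _
  rw [mode_comm, ← sub_eq_add_neg]
  simp only [sub_eq_zero]
  by_cases h : s = 1 <;> simp [h]

theorem mode_zero_quadHom (x y z : g) :
    mode κ x 0 (quadHom κ y z) = quadHom κ ⁅x, y⁆ z + quadHom κ y ⁅x, z⁆ := by
  rw [mode_quadHom, mode_zero_stateHom κ x z 1 one_ne_zero, if_neg (by omega), zero_smul, add_zero,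
    add_comm]
  rfl

/-- The first product is the source of the iterated brackets `[[x, y], z]`. -/
theorem mode_one_quadHom (x y z : g) :
    mode κ x 1 (quadHom κ y z) = stateHom κ 1 ⁅⁅x, y⁆, z⁆ + κ.form x y • stateHom κ 1 z
      + κ.form x z • stateHom κ 1 y := by
  rw [mode_quadHom, mode_one_stateHom_one, sub_self, mode_zero_stateHom κ _ z 1 one_ne_zero,
    if_pos rfl, map_smul]
  change κ.form x z • stateHom κ 1 y + _ + _ = _
  abel

theorem mode_two_quadHom (x y z : g) :
    mode κ x 2 (quadHom κ y z) = κ.form ⁅x, y⁆ z • vacuum κ := by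
  rw [mode_quadHom, mode_stateHom_eq_zero κ x z 2 1 (by norm_num), map_zero, if_neg (by omega),
    zero_smul, add_zero, zero_add]
  exact mode_one_stateHom_one κ _ z

theorem mode_quadHom_eq_zero (x y z : g) (s : ℤ) (h : 2 < s) :
    mode κ x s (quadHom κ y z) = 0 := by
  rw [mode_quadHom, mode_stateHom_eq_zero κ x z s 1 (by omega), map_zero, if_neg (by omega),
    mode_stateHom_eq_zero κ _ z _ 1 (by omega), zero_smul, add_zero, add_zero]

end AffineVertex

namespace WAlgebraGL

/-! ### Brackets and invariant form on the matrix units of `b` -/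

variable (m n : ℕ)

theorem unit_coe {i j : Fin (m + n)} (h : col m n j ≤ col m n i) :
    (unit m n i j : Matrix (Fin (m + n)) (Fin (m + n)) ℂ) = Matrix.single i j 1 := by
  rw [unit, dif_pos h]

theorem unit_lie_unit {a b c d : Fin (m + n)} (hab : col m n b ≤ col m n a)
    (hcd : col m n d ≤ col m n c) :
    ⁅unit m n a b, unit m n c d⁆ = delta (b = c) • unit m n a d - delta (a = d) • unit m n c b := by
  have key : ∀ {a b c d : Fin (m + n)}, col m n b ≤ col m n a → col m n d ≤ col m n c →
      (Matrix.single a b (1 : ℂ) * Matrix.single c d 1 : Matrix _ _ ℂ) =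
        delta (b = c) • (unit m n a d : Matrix (Fin (m + n)) (Fin (m + n)) ℂ) := by
    intro a b c d hab hcd
    by_cases h : b = c
    · subst h
      rw [unit_coe m n (hcd.trans hab), Matrix.single_mul_single_same, delta, if_pos rfl, one_smul,
        one_mul]
    · rw [Matrix.single_mul_single_of_ne _ _ _ _ h, delta, if_neg h, zero_smul]
  refine Subtype.ext ?_
  change (unit m n a b : Matrix (Fin (m + n)) (Fin (m + n)) ℂ) * unit m n c d -
    (unit m n c d : Matrix (Fin (m + n)) (Fin (m + n)) ℂ) * unit m n a b = _
  rw [unit_coe m n hab, unit_coe m n hcd, key hab hcd, key hcd hab]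
  simp only [eq_comm (a := d)]
  rfl

theorem col_idx (a : Fin m) : col m n (idx m n a) = 1 := by
  simp [col, idx]

theorem col_hat {a : Fin m} (ha : m - n ≤ (a : ℕ)) : col m n (hat m n a) = 2 := by
  rw [col, if_neg]
  simp only [hat, Fin.val_addNat]
  omega

theorem idx_inj {a b : Fin m} : idx m n a = idx m n b ↔ a = b :=
  (Fin.castAdd_injective m n).eq_iff

theorem hat_inj {a b : Fin m} : hat m n a = hat m n b ↔ a = b := by
  simp [hat, Fin.ext_iff]

theorem idx_ne_hat {a b : Fin m} (hb : m - n ≤ (b : ℕ)) : idx m n a ≠ hat m n b := by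
  intro h
  have := congrArg (col m n) h
  rw [col_idx, col_hat m n hb] at this
  omega

/-- The matrix unit `e_{a,b}` of the first diagonal block, indexed by rows. -/
def e₁₁ (a b : Fin m) : subalgB m n := unit m n (idx m n a) (idx m n b)

/-- The matrix unit `e_{â,b̂}` of the second diagonal block, indexed by rows `a, b > m - n`. -/
def e₂₂ (a b : Fin m) : subalgB m n := unit m n (hat m n a) (hat m n b)

/-- The matrix unit `e_{â,b}` of the off-diagonal block, indexed by rows, with `a > m - n`. -/
def e₂₁ (a b : Fin m) : subalgB m n := unit m n (hat m n a) (idx m n b)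

variable {m n}

theorem e₁₁_lie_e₁₁ (a b c d : Fin m) :
    ⁅e₁₁ m n a b, e₁₁ m n c d⁆ = delta (b = c) • e₁₁ m n a d - delta (a = d) • e₁₁ m n c b := by
  rw [e₁₁, e₁₁, unit_lie_unit m n (by simp only [col_idx, le_refl]) (by simp only [col_idx, le_refl])]
  simp only [delta, idx_inj]
  rfl

theorem e₂₂_lie_e₂₂ {a b c d : Fin m} (ha : m - n ≤ (a : ℕ)) (hb : m - n ≤ (b : ℕ))
    (hc : m - n ≤ (c : ℕ)) (hd : m - n ≤ (d : ℕ)) :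
    ⁅e₂₂ m n a b, e₂₂ m n c d⁆ = delta (b = c) • e₂₂ m n a d - delta (a = d) • e₂₂ m n c b := by
  rw [e₂₂, e₂₂, unit_lie_unit m n (by rw [col_hat m n ha, col_hat m n hb])
    (by rw [col_hat m n hc, col_hat m n hd])]
  simp only [delta, hat_inj]
  rfl

theorem e₁₁_lie_e₂₂ (a b : Fin m) {c d : Fin m} (hc : m - n ≤ (c : ℕ)) (hd : m - n ≤ (d : ℕ)) :
    ⁅e₁₁ m n a b, e₂₂ m n c d⁆ = 0 := by
  rw [e₁₁, e₂₂, unit_lie_unit m n (by simp only [col_idx, le_refl])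
    (by rw [col_hat m n hc, col_hat m n hd])]
  simp [delta, idx_ne_hat m n hc, idx_ne_hat m n hd]

theorem e₂₂_lie_e₁₁ {a b : Fin m} (c d : Fin m) (ha : m - n ≤ (a : ℕ)) (hb : m - n ≤ (b : ℕ)) :
    ⁅e₂₂ m n a b, e₁₁ m n c d⁆ = 0 := by
  rw [← lie_skew, e₁₁_lie_e₂₂ c d ha hb, neg_zero]

theorem e₁₁_lie_e₂₁ (a b : Fin m) {c : Fin m} (d : Fin m) (hc : m - n ≤ (c : ℕ)) :
    ⁅e₁₁ m n a b, e₂₁ m n c d⁆ = -(delta (a = d) • e₂₁ m n c b) := by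
  rw [e₁₁, e₂₁, unit_lie_unit m n (by simp only [col_idx, le_refl])
    (by rw [col_hat m n hc, col_idx]; omega)]
  simp only [delta, idx_ne_hat m n hc, idx_inj, if_false, zero_smul, zero_sub]
  rfl

theorem e₂₂_lie_e₂₁ {a b c : Fin m} (d : Fin m) (ha : m - n ≤ (a : ℕ)) (hb : m - n ≤ (b : ℕ))
    (hc : m - n ≤ (c : ℕ)) : ⁅e₂₂ m n a b, e₂₁ m n c d⁆ = delta (b = c) • e₂₁ m n a d := by
  rw [e₂₂, e₂₁, unit_lie_unit m n (by rw [col_hat m n ha, col_hat m n hb])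
    (by rw [col_hat m n hc, col_idx]; omega)]
  simp only [delta, (idx_ne_hat m n ha).symm, hat_inj, if_false, zero_smul, sub_zero]
  rfl

theorem block₁_e₁₁ (a b : Fin m) : block₁ m n (e₁₁ m n a b) = Matrix.single a b 1 := by
  rw [block₁, e₁₁, unit_coe m n (by simp only [col_idx, le_refl])]
  ext i j
  simp [Matrix.single_apply, idx]

theorem block₂_e₁₁ (a b : Fin m) : block₂ m n (e₁₁ m n a b) = 0 := by
  rw [block₂, e₁₁, unit_coe m n (by simp only [col_idx, le_refl])]
  ext i j
  have h : idx m n a ≠ Fin.natAdd m i := by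
    simp only [ne_eq, Fin.ext_iff, idx, Fin.val_castAdd, Fin.val_natAdd]
    omega
  simp [h]

theorem block₁_unit_hat {a : Fin m} (b : Fin (m + n)) (ha : m - n ≤ (a : ℕ)) :
    block₁ m n (unit m n (hat m n a) b) = 0 := by
  have hc := col_hat m n ha
  have hb : col m n b ≤ 2 := by unfold col; split_ifs <;> omega
  rw [block₁, unit_coe m n (by omega)]
  ext i j
  have h : hat m n a ≠ Fin.castAdd n i := (idx_ne_hat m n ha).symm
  simp [h]

theorem block₂_e₂₁ {a : Fin m} (b : Fin m) (ha : m - n ≤ (a : ℕ)) :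
    block₂ m n (e₂₁ m n a b) = 0 := by
  rw [block₂, e₂₁, unit_coe m n (by rw [col_hat m n ha, col_idx]; omega)]
  ext i j
  have h : idx m n b ≠ Fin.natAdd m j := by
    simp only [ne_eq, Fin.ext_iff, idx, Fin.val_castAdd, Fin.val_natAdd]
    omega
  simp [h]

/-- The rows of the second block start at `m - n`, whence the shift of the indices. -/
theorem block₂_e₂₂ (hnm : n ≤ m) {a b : Fin m} (ha : m - n ≤ (a : ℕ)) (hb : m - n ≤ (b : ℕ)) :
    block₂ m n (e₂₂ m n a b) =
      Matrix.single ⟨a - (m - n), by omega⟩ ⟨b - (m - n), by omega⟩ 1 := by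
  rw [block₂, e₂₂, unit_coe m n (by rw [col_hat m n ha, col_hat m n hb])]
  ext i j
  simp only [Matrix.submatrix_apply, Matrix.single_apply, hat, Fin.ext_iff, Fin.val_addNat,
    Fin.val_natAdd]
  congr 1
  rw [eq_iff_iff]
  omega

theorem trace_single {l : ℕ} (a b : Fin l) :
    (Matrix.single a b (1 : ℂ)).trace = delta (a = b) := by
  by_cases h : a = b
  · subst h
    simp [delta]
  · rw [Matrix.trace_single_eq_of_ne _ _ _ h, delta, if_neg h]

theorem trace_single_mul_single {l : ℕ} (a b c d : Fin l) :
    (Matrix.single a b (1 : ℂ) * Matrix.single c d 1).trace = delta (b = c) * delta (a = d) := by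
  by_cases h : b = c
  · subst h
    have h₁ : delta (b = b) = 1 := if_pos rfl
    rw [Matrix.single_mul_single_same, mul_one, trace_single, h₁, one_mul]
  · rw [Matrix.single_mul_single_of_ne _ _ _ _ h, Matrix.trace_zero, delta, if_neg h, zero_mul]

theorem kappa_apply (k : ℂ) (x y : subalgB m n) : (kappa m n k).form x y =
    alpha₁ n k * (block₁ m n x * block₁ m n y).trace
      + (block₁ m n x).trace * (block₁ m n y).trace
      + (alpha₂ m k * (block₂ m n x * block₂ m n y).trace
      + (block₂ m n x).trace * (block₂ m n y).trace) := rfl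

variable (k : ℂ)

theorem kappa_e₁₁_e₁₁ (a b c d : Fin m) : (kappa m n k).form (e₁₁ m n a b) (e₁₁ m n c d) =
    alpha₁ n k * (delta (b = c) * delta (a = d)) + delta (a = b) * delta (c = d) := by
  simp [kappa_apply, block₁_e₁₁, block₂_e₁₁, trace_single_mul_single, trace_single]

theorem kappa_e₂₂_e₂₂ (hnm : n ≤ m) {a b c d : Fin m} (ha : m - n ≤ (a : ℕ)) (hb : m - n ≤ (b : ℕ))
    (hc : m - n ≤ (c : ℕ)) (hd : m - n ≤ (d : ℕ)) :
    (kappa m n k).form (e₂₂ m n a b) (e₂₂ m n c d) =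
      alpha₂ m k * (delta (b = c) * delta (a = d)) + delta (a = b) * delta (c = d) := by
  have h : ∀ {x y : Fin m}, m - n ≤ (x : ℕ) → m - n ≤ (y : ℕ) →
      ((x : ℕ) - (m - n) = y - (m - n) ↔ (x : ℕ) = y) := fun _ _ => by omega
  have h₁ : ∀ x y : Fin m, m - n ≤ (x : ℕ) → block₁ m n (e₂₂ m n x y) = 0 := fun x y hx =>
    block₁_unit_hat _ hx
  simp [kappa_apply, h₁ a b ha, block₂_e₂₂ hnm ha hb, block₂_e₂₂ hnm hc hd, trace_single_mul_single,
    trace_single, delta, Fin.ext_iff, h hb hc, h ha hd, h ha hb, h hc hd]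

theorem kappa_e₁₁_e₂₂ (a b : Fin m) {c : Fin m} (d : Fin m) (hc : m - n ≤ (c : ℕ)) :
    (kappa m n k).form (e₁₁ m n a b) (e₂₂ m n c d) = 0 := by
  have h₁ : block₁ m n (e₂₂ m n c d) = 0 := block₁_unit_hat _ hc
  simp [kappa_apply, block₂_e₁₁, h₁]

theorem kappa_e₂₂_e₁₁ {a : Fin m} (b c d : Fin m) (ha : m - n ≤ (a : ℕ)) :
    (kappa m n k).form (e₂₂ m n a b) (e₁₁ m n c d) = 0 := by
  have h₁ : block₁ m n (e₂₂ m n a b) = 0 := block₁_unit_hat _ ha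
  simp [kappa_apply, block₂_e₁₁, h₁]

theorem kappa_e₂₁ (x : subalgB m n) {c : Fin m} (d : Fin m) (hc : m - n ≤ (c : ℕ)) :
    (kappa m n k).form x (e₂₁ m n c d) = 0 := by
  have h₁ : block₁ m n (e₂₁ m n c d) = 0 := block₁_unit_hat _ hc
  simp [kappa_apply, block₂_e₂₁ d hc, h₁]

/-! ### The generators as vectors over the matrix units -/

theorem row_eq_iff (hnm : n ≤ m) {h : Fin (m + n)} {a : Fin m} :
    row m n h = a ↔ h = idx m n a ∨ (m - n ≤ (a : ℕ) ∧ h = hat m n a) := by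
  simp only [row, idx, hat, Fin.ext_iff, Fin.val_castAdd, Fin.val_addNat]
  split_ifs <;> omega

theorem row_col_iff (hnm : n ≤ m) {h l : Fin (m + n)} {p q : Fin m} :
    (row m n h = p ∧ row m n l = q ∧ col m n h = col m n l) ↔
      (h = idx m n p ∧ l = idx m n q) ∨
        ((m - n ≤ (p : ℕ) ∧ m - n ≤ (q : ℕ)) ∧ h = hat m n p ∧ l = hat m n q) := by
  rw [row_eq_iff hnm, row_eq_iff hnm]
  constructor
  · rintro ⟨rfl | ⟨hp, rfl⟩, rfl | ⟨hq, rfl⟩, hc⟩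
    · exact Or.inl ⟨rfl, rfl⟩
    · rw [col_idx, col_hat m n hq] at hc
      omega
    · rw [col_idx, col_hat m n hp] at hc
      omega
    · exact Or.inr ⟨⟨hp, hq⟩, rfl, rfl⟩
  · rintro (⟨rfl, rfl⟩ | ⟨⟨hp, hq⟩, rfl, rfl⟩)
    · exact ⟨Or.inl rfl, Or.inl rfl, by rw [col_idx, col_idx]⟩
    · exact ⟨Or.inr ⟨hp, rfl⟩, Or.inr ⟨hq, rfl⟩, by rw [col_hat m n hp, col_hat m n hq]⟩

/-- The element `X` of `b` with `W^{(1)}_{p,q} = X[-1]`. Its component in the second block is cut off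
by the indicator, since the indices `p̂` and `q̂` exist only for `p, q > m - n`. -/
def w₁ (m n : ℕ) (p q : Fin m) : subalgB m n :=
  e₁₁ m n p q + delta (m - n ≤ (p : ℕ) ∧ m - n ≤ (q : ℕ)) • e₂₂ m n p q

theorem W₁_eq (hnm : n ≤ m) (p q : Fin m) :
    W₁ m n k p q = stateHom (kappa m n k) 1 (w₁ m n p q) := by
  have key : ∀ h l : Fin (m + n),
      (if row m n h = p ∧ row m n l = q ∧ col m n h = col m n l then eState m n k h l 1 else 0) =
      (if h = idx m n p then if l = idx m n q then eState m n k h l 1 else 0 else 0) +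
      delta (m - n ≤ (p : ℕ) ∧ m - n ≤ (q : ℕ)) •
        (if h = hat m n p then if l = hat m n q then eState m n k h l 1 else 0 else 0) := by
    intro h l
    rw [if_congr (row_col_iff hnm) rfl rfl, ← ite_and, ← ite_and]
    by_cases hpq : m - n ≤ (p : ℕ) ∧ m - n ≤ (q : ℕ)
    · by_cases h₁ : h = idx m n p ∧ l = idx m n q
      · have h₂ : ¬ (h = hat m n p ∧ l = hat m n q) := fun h₂ =>
          idx_ne_hat m n hpq.1 (h₁.1.symm.trans h₂.1)
        rw [if_pos (Or.inl h₁), if_pos h₁, if_neg h₂, smul_zero, add_zero]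
      · rw [if_neg h₁, zero_add, delta, if_pos hpq, one_smul]
        exact if_congr ⟨fun h => (h.resolve_left h₁).2, fun h => Or.inr ⟨hpq, h⟩⟩ rfl rfl
    · rw [delta, if_neg hpq, zero_smul, add_zero]
      exact if_congr ⟨fun h => h.resolve_right fun h' => hpq h'.1, Or.inl⟩ rfl rfl
  rw [W₁, w₁, map_add, map_smul]
  simp only [key, Finset.sum_add_distrib, ← Finset.smul_sum]
  simp only [Finset.sum_ite_irrel, Finset.sum_const_zero, Finset.sum_ite_eq', Finset.mem_univ,
    if_true]
  rfl

theorem W₂_eq (i j : Fin m) : W₂ m n k i j =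
    stateHom (kappa m n k) 1 (e₂₁ m n i j) - alpha₂ m k • stateHom (kappa m n k) 2 (e₁₁ m n i j)
      + ∑ u : Fin m with m - n ≤ u.val, quadHom (kappa m n k) (e₁₁ m n u j) (e₂₂ m n i u)
      - ∑ u : Fin m with u.val < m - n, quadHom (kappa m n k) (e₁₁ m n u j) (e₁₁ m n i u) := by
  simp only [← nthProduct_stateHom_stateHom]
  rfl

/-! ### The products of `W^{(1)}` with `W^{(2)}` -/

theorem delta_pos {P : Prop} [Decidable P] (h : P) : delta P = 1 := if_pos h

theorem delta_neg {P : Prop} [Decidable P] (h : ¬ P) : delta P = 0 := if_neg h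

theorem w₁_of_lt {p : Fin m} (q : Fin m) (hp : (p : ℕ) < m - n) : w₁ m n p q = e₁₁ m n p q := by
  rw [w₁, delta, if_neg (by omega), zero_smul, add_zero]

theorem w₁_of_le {p q : Fin m} (hp : m - n ≤ (p : ℕ)) (hq : m - n ≤ (q : ℕ)) :
    w₁ m n p q = e₁₁ m n p q + e₂₂ m n p q := by
  rw [w₁, delta, if_pos ⟨hp, hq⟩, one_smul]

/-- The action of `W^{(1)}_{p,q}` on the off-diagonal block. -/
theorem w₁_lie_e₂₁ (p q : Fin m) {i : Fin m} (j : Fin m) (hi : m - n ≤ (i : ℕ)) :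
    ⁅w₁ m n p q, e₂₁ m n i j⁆ = delta (i = q) • delta (m - n ≤ (p : ℕ)) • e₂₁ m n p j
      - delta (p = j) • e₂₁ m n i q := by
  rw [w₁, add_lie, smul_lie, e₁₁_lie_e₂₁ _ _ _ hi]
  by_cases h : m - n ≤ (p : ℕ) ∧ m - n ≤ (q : ℕ)
  · rw [e₂₂_lie_e₂₁ _ h.1 h.2 hi]
    simp only [delta, h, and_self, if_true, eq_comm (a := i)]
    module
  · have : delta (i = q) * delta (m - n ≤ (p : ℕ)) = 0 := by
      simp only [delta]
      split_ifs with h₁ h₂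
      · exact absurd ⟨h₂, h₁ ▸ hi⟩ h
      all_goals simp
    rw [smul_smul, this, delta_neg h]
    module

theorem w₁_lie_e₁₁ (p q a b : Fin m) :
    ⁅w₁ m n p q, e₁₁ m n a b⁆ = delta (q = a) • e₁₁ m n p b - delta (p = b) • e₁₁ m n a q := by
  rw [w₁, add_lie, smul_lie, e₁₁_lie_e₁₁]
  by_cases h : m - n ≤ (p : ℕ) ∧ m - n ≤ (q : ℕ)
  · rw [e₂₂_lie_e₁₁ _ _ h.1 h.2, smul_zero, add_zero]
  · rw [delta_neg h, zero_smul, add_zero]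

theorem kappa_w₁_e₁₁ (p q a b : Fin m) : (kappa m n k).form (w₁ m n p q) (e₁₁ m n a b) =
    alpha₁ n k * (delta (q = a) * delta (p = b)) + delta (p = q) * delta (a = b) := by
  rw [w₁, map_add, LinearMap.add_apply, map_smul, LinearMap.smul_apply, kappa_e₁₁_e₁₁]
  by_cases h : m - n ≤ (p : ℕ) ∧ m - n ≤ (q : ℕ)
  · rw [kappa_e₂₂_e₁₁ k _ _ _ h.1, smul_zero, add_zero]
  · rw [delta_neg h, zero_smul, add_zero]

/-- `W^{(1)}_{p,q}` acts on the second diagonal block through its component there, which vanishes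
unless `p > m - n`. -/
theorem w₁_lie_e₂₂ (p q : Fin m) {a b : Fin m} (hpq : m - n ≤ (p : ℕ) → m - n ≤ (q : ℕ))
    (ha : m - n ≤ (a : ℕ)) (hb : m - n ≤ (b : ℕ)) :
    ⁅w₁ m n p q, e₂₂ m n a b⁆ = delta (m - n ≤ (p : ℕ)) •
      (delta (q = a) • e₂₂ m n p b - delta (p = b) • e₂₂ m n a q) := by
  rw [w₁, add_lie, smul_lie, e₁₁_lie_e₂₂ _ _ ha hb, zero_add]
  by_cases h : m - n ≤ (p : ℕ)
  · rw [e₂₂_lie_e₂₂ h (hpq h) ha hb]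
    simp [delta, h, hpq h]
  · simp [delta, h]

theorem kappa_w₁_e₂₂ (hnm : n ≤ m) (p q : Fin m) {a b : Fin m}
    (hpq : m - n ≤ (p : ℕ) → m - n ≤ (q : ℕ)) (ha : m - n ≤ (a : ℕ)) (hb : m - n ≤ (b : ℕ)) :
    (kappa m n k).form (w₁ m n p q) (e₂₂ m n a b) = delta (m - n ≤ (p : ℕ)) *
      (alpha₂ m k * (delta (q = a) * delta (p = b)) + delta (p = q) * delta (a = b)) := by
  rw [w₁, map_add, LinearMap.add_apply, map_smul, LinearMap.smul_apply, kappa_e₁₁_e₂₂ k _ _ _ ha,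
    zero_add]
  by_cases h : m - n ≤ (p : ℕ)
  · rw [kappa_e₂₂_e₂₂ k hnm h (hpq h) ha hb]
    simp [delta, h, hpq h]
  · simp [delta, h]

theorem alpha₂_sub_alpha₁ (hnm : n ≤ m) : alpha₂ m k - alpha₁ n k = (m - n : ℕ) := by
  rw [alpha₂, alpha₁, Nat.cast_sub hnm]
  ring

theorem card_rows_lt : (Finset.univ.filter fun u : Fin m => u.val < m - n).card = m - n := by
  rw [Fin.card_filter_val_lt]
  omega

theorem sum_delta_smul {V : Type*} [AddCommGroup V] [Module ℂ V] (P : Fin m → Prop)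
    [DecidablePred P] (a : Fin m) (f : Fin m → V) :
    ∑ u with P u, delta (a = u) • f u = delta (P a) • f a := by
  simp only [delta, ite_smul, one_smul, zero_smul, Finset.sum_ite_eq, Finset.mem_filter,
    Finset.mem_univ, true_and]

theorem sum_delta_smul' {V : Type*} [AddCommGroup V] [Module ℂ V] (P : Fin m → Prop)
    [DecidablePred P] (a : Fin m) (f : Fin m → V) :
    ∑ u with P u, delta (u = a) • f u = delta (P a) • f a := by
  simp only [eq_comm (b := a), sum_delta_smul]

/-- The `0`-th product, on which `W^{(1)}_{p,q}` acts as a derivation. -/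
theorem W₁_zero_W₂ (hnm : n ≤ m) (p q i j : Fin m) (hpq : m - n ≤ (p : ℕ) → m - n ≤ (q : ℕ))
    (hi : m - n ≤ (i : ℕ)) :
    (W₁ m n k p q).nthProduct 0 (W₂ m n k i j) =
        -(delta (p = j) • W₂ m n k i q)
        + (delta (i = q) * delta (m - n ≤ (p : ℕ))) • W₂ m n k p j
        - (delta (i = q) * delta ((p : ℕ) < m - n)) •
            ∑ w : Fin m with w.val < m - n, (W₁ m n k w j).nthProduct (-1) (W₁ m n k p w)
        - (delta (i = q) * delta ((p : ℕ) < m - n) * alpha₂ m k) • (W₁ m n k p j).translation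
        + delta ((p : ℕ) < m - n ∧ m - n ≤ (q : ℕ)) •
            (W₁ m n k p j).nthProduct (-1) (W₁ m n k i q) := by
  have hqi : delta (q = i) = delta (i = q) := by simp only [eq_comm]
  have h₂ : ∑ u : Fin m with m - n ≤ u.val, mode (kappa m n k) (w₁ m n p q) 0
      (quadHom (kappa m n k) (e₁₁ m n u j) (e₂₂ m n i u)) =
      ∑ u : Fin m with m - n ≤ u.val, (
        delta (q = u) • quadHom (kappa m n k) (e₁₁ m n p j) (e₂₂ m n i u)
        - delta (p = j) • quadHom (kappa m n k) (e₁₁ m n u q) (e₂₂ m n i u)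
        + (delta (m - n ≤ (p : ℕ)) * delta (i = q)) •
            quadHom (kappa m n k) (e₁₁ m n u j) (e₂₂ m n p u)
        - delta (p = u) • delta (m - n ≤ (p : ℕ)) •
            quadHom (kappa m n k) (e₁₁ m n u j) (e₂₂ m n i q)) := by
    refine Finset.sum_congr rfl fun u hu => ?_
    rw [mode_zero_quadHom, w₁_lie_e₁₁, w₁_lie_e₂₂ p q hpq hi (Finset.mem_filter.1 hu).2, hqi]
    simp only [map_sub, map_smul, LinearMap.sub_apply, LinearMap.smul_apply]
    module
  have h₁ : ∑ u : Fin m with u.val < m - n, mode (kappa m n k) (w₁ m n p q) 0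
      (quadHom (kappa m n k) (e₁₁ m n u j) (e₁₁ m n i u)) =
      ∑ u : Fin m with u.val < m - n, (
        delta (q = u) • quadHom (kappa m n k) (e₁₁ m n p j) (e₁₁ m n i u)
        - delta (p = j) • quadHom (kappa m n k) (e₁₁ m n u q) (e₁₁ m n i u)
        + delta (i = q) • quadHom (kappa m n k) (e₁₁ m n u j) (e₁₁ m n p u)
        - delta (p = u) • quadHom (kappa m n k) (e₁₁ m n u j) (e₁₁ m n i q)) := by
    refine Finset.sum_congr rfl fun u hu => ?_
    rw [mode_zero_quadHom, w₁_lie_e₁₁, w₁_lie_e₁₁, hqi]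
    simp only [map_sub, map_smul, LinearMap.sub_apply, LinearMap.smul_apply]
    module
  have hW : ∑ w : Fin m with w.val < m - n,
      quadHom (kappa m n k) (w₁ m n w j) (w₁ m n p w) =
      ∑ w : Fin m with w.val < m - n, quadHom (kappa m n k) (e₁₁ m n w j) (w₁ m n p w) :=
    Finset.sum_congr rfl fun w hw => by rw [w₁_of_lt j (Finset.mem_filter.1 hw).2]
  simp only [W₁_eq k hnm, nthProduct_stateHom, translation_stateHom, mode_neg_one_stateHom, W₂_eq,
    map_sub, map_add, map_smul, map_sum]
  rw [h₁, h₂, mode_zero_stateHom _ _ _ 1 one_ne_zero, mode_zero_stateHom _ _ _ 2 two_ne_zero,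
    w₁_lie_e₂₁ _ _ _ hi, w₁_lie_e₁₁, hqi, hW]
  simp only [Finset.sum_sub_distrib, Finset.sum_add_distrib, sum_delta_smul, ← Finset.smul_sum,
    map_sub, map_smul]
  rcases lt_or_ge (p : ℕ) (m - n) with hp | hp
  · have hp' : ¬ m - n ≤ (p : ℕ) := by omega
    simp only [w₁_of_lt _ hp, delta_pos hp, delta_neg (not_le.2 hp)]
    rcases lt_or_ge (q : ℕ) (m - n) with hq | hq
    · have hiq : delta (i = q) = 0 := delta_neg (by rintro rfl; omega)
      simp only [delta_pos hq, delta_neg (not_le.2 hq), hiq,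
        delta_neg fun h : (p : ℕ) < m - n ∧ m - n ≤ (q : ℕ) => not_le.2 hq h.2]
      module
    · simp only [delta_neg (not_lt.2 hq), delta_pos hq, delta_pos (And.intro hp hq),
        w₁_of_le hi hq, map_add]
      module
  · have hq := hpq hp
    simp only [delta_neg (not_lt.2 hp), delta_neg (not_lt.2 hq),
      delta_pos hp, delta_pos hq,
      delta_neg fun h : (p : ℕ) < m - n ∧ m - n ≤ (q : ℕ) => not_lt.2 hp h.1]
    module

/-- The first product. Its term with `α₁` and `E_{i,q}` comes from `α₂ E_{i,q}` and the `m - n`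
iterated brackets of the last sum in `W^{(2)}_{i,j}`, since `α₂ - (m - n) = α₁`. -/
theorem W₁_one_W₂ (hnm : n ≤ m) (p q i j : Fin m) (hpq : m - n ≤ (p : ℕ) → m - n ≤ (q : ℕ))
    (hi : m - n ≤ (i : ℕ)) :
    (W₁ m n k p q).nthProduct 1 (W₂ m n k i j) =
        (delta (p = j) * alpha₁ n k * delta (m - n ≤ (q : ℕ))) • W₁ m n k i q
        - (delta (i = q) * delta ((p : ℕ) < m - n) * (alpha₂ m k + alpha₁ n k)) • W₁ m n k p j
        + (delta (p = q) * delta (m - n ≤ (j : ℕ))) • W₁ m n k i j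
        - (delta (i = j) * delta ((q : ℕ) < m - n)) • W₁ m n k p q
        + (delta (p = j) * delta (q = i)) • ∑ w : Fin m with w.val < m - n, W₁ m n k w w := by
  have hqi : delta (q = i) = delta (i = q) := by simp only [eq_comm]
  have hji : delta (j = i) = delta (i = j) := by simp only [eq_comm]
  have h₂ : ∑ u : Fin m with m - n ≤ u.val, mode (kappa m n k) (w₁ m n p q) 1
      (quadHom (kappa m n k) (e₁₁ m n u j) (e₂₂ m n i u)) =
      ∑ u : Fin m with m - n ≤ u.val, (
        delta (q = u) • (alpha₁ n k * delta (p = j)) • stateHom (kappa m n k) 1 (e₂₂ m n i u)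
        + delta (u = j) • delta (p = q) • stateHom (kappa m n k) 1 (e₂₂ m n i u)
        + delta (p = u) • (delta (m - n ≤ (p : ℕ)) * alpha₂ m k * delta (i = q)) •
            stateHom (kappa m n k) 1 (e₁₁ m n u j)
        + delta (i = u) • (delta (m - n ≤ (p : ℕ)) * delta (p = q)) •
            stateHom (kappa m n k) 1 (e₁₁ m n u j)) := by
    refine Finset.sum_congr rfl fun u hu => ?_
    have hu := (Finset.mem_filter.1 hu).2
    rw [mode_one_quadHom, w₁_lie_e₁₁, sub_lie, smul_lie, smul_lie, e₁₁_lie_e₂₂ _ _ hi hu,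
      e₁₁_lie_e₂₂ _ _ hi hu, kappa_w₁_e₁₁, kappa_w₁_e₂₂ k hnm p q hpq hi hu, hqi]
    simp only [smul_zero, sub_zero, map_zero]
    module
  have h₁ : ∑ u : Fin m with u.val < m - n, mode (kappa m n k) (w₁ m n p q) 1
      (quadHom (kappa m n k) (e₁₁ m n u j) (e₁₁ m n i u)) =
      ∑ u : Fin m with u.val < m - n, (
        delta (q = u) • delta (i = j) • stateHom (kappa m n k) 1 (e₁₁ m n p u)
        - delta (q = u) • delta (p = u) • stateHom (kappa m n k) 1 (e₁₁ m n i j)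
        - (delta (p = j) * delta (i = q)) • stateHom (kappa m n k) 1 (e₁₁ m n u u)
        + delta (p = j) • stateHom (kappa m n k) 1 (e₁₁ m n i q)
        + delta (q = u) • (alpha₁ n k * delta (p = j)) • stateHom (kappa m n k) 1 (e₁₁ m n i u)
        + delta (u = j) • delta (p = q) • stateHom (kappa m n k) 1 (e₁₁ m n i u)
        + delta (p = u) • (alpha₁ n k * delta (i = q)) •
            stateHom (kappa m n k) 1 (e₁₁ m n u j)) := by
    refine Finset.sum_congr rfl fun u hu => ?_
    have hu := (Finset.mem_filter.1 hu).2
    have hiu : i ≠ u := by rintro rfl; omega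
    rw [mode_one_quadHom, w₁_lie_e₁₁, sub_lie, smul_lie, smul_lie, e₁₁_lie_e₁₁, e₁₁_lie_e₁₁,
      kappa_w₁_e₁₁, kappa_w₁_e₁₁, hqi, hji, delta_neg hiu, delta_pos (rfl : u = u)]
    simp only [map_sub, map_smul]
    module
  have hW : ∑ w : Fin m with w.val < m - n, stateHom (kappa m n k) 1 (w₁ m n w w) =
      ∑ w : Fin m with w.val < m - n, stateHom (kappa m n k) 1 (e₁₁ m n w w) :=
    Finset.sum_congr rfl fun w hw => by rw [w₁_of_lt w (Finset.mem_filter.1 hw).2]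
  have hα : alpha₂ m k = alpha₁ n k + (m - n : ℕ) := by rw [← alpha₂_sub_alpha₁ k hnm]; ring
  simp only [W₁_eq k hnm, nthProduct_stateHom, W₂_eq, map_sub, map_add, map_smul, map_sum]
  rw [h₁, h₂, mode_one_stateHom_one, kappa_e₂₁ k _ _ hi, zero_smul, mode_one_stateHom_two,
    w₁_lie_e₁₁, hqi, hW]
  simp only [Finset.sum_sub_distrib, Finset.sum_add_distrib, sum_delta_smul, sum_delta_smul',
    ← Finset.smul_sum, map_sub, map_smul, Finset.sum_const, card_rows_lt, delta_pos hi]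
  rw [← Nat.cast_smul_eq_nsmul ℂ, hα]
  -- `W^{(1)}_{i,j}` has a component in the second block only for `j > m - n`.
  have hj : (delta (m - n ≤ (j : ℕ)) = 0 ∧ delta ((j : ℕ) < m - n) = 1) ∨
      (delta (m - n ≤ (j : ℕ)) = 1 ∧ delta ((j : ℕ) < m - n) = 0 ∧
        w₁ m n i j = e₁₁ m n i j + e₂₂ m n i j) := by
    rcases lt_or_ge (j : ℕ) (m - n) with h | h
    · exact Or.inl ⟨delta_neg (not_le.2 h), delta_pos h⟩
    · exact Or.inr ⟨delta_pos h, delta_neg (not_lt.2 h), w₁_of_le hi h⟩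
  rcases lt_or_ge (p : ℕ) (m - n) with hp | hp
  · simp only [w₁_of_lt _ hp, delta_pos hp, delta_neg (not_le.2 hp)]
    rcases lt_or_ge (q : ℕ) (m - n) with hq | hq
    · have hiq : delta (i = q) = 0 := delta_neg (by rintro rfl; omega)
      simp only [delta_pos hq, delta_neg (not_le.2 hq), hiq]
      rcases hj with ⟨h, h'⟩ | ⟨h, h', hw⟩
      · simp only [h, h']
        module
      · simp only [h, h', hw, map_add]
        module
    · have hp_ne : delta (p = q) = 0 := delta_neg (by rintro rfl; omega)
      simp only [delta_neg (not_lt.2 hq), delta_pos hq, hp_ne, w₁_of_le hi hq, map_add]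
      module
  · have hq := hpq hp
    simp only [delta_neg (not_lt.2 hp), delta_neg (not_lt.2 hq), delta_pos hp, delta_pos hq,
      w₁_of_le hi hq, map_add]
    rcases hj with ⟨h, h'⟩ | ⟨h, h', hw⟩
    · simp only [h, h']
      module
    · simp only [h, h', hw, map_add]
      module

/-- The second product. The quadratic terms in the levels combine through
`-2 α₂ α₁ + (m - n) α₁ = -(α₁ + α₂) α₁`. -/
theorem W₁_two_W₂ (hnm : n ≤ m) (p q i j : Fin m) (hpq : m - n ≤ (p : ℕ) → m - n ≤ (q : ℕ))
    (hi : m - n ≤ (i : ℕ)) :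
    (W₁ m n k p q).nthProduct 2 (W₂ m n k i j) =
        (-(delta (q = i) * delta (p = j) * ((alpha₁ n k + alpha₂ m k) * alpha₁ n k))
          - delta (p = q) * delta (i = j) *
            (delta ((p : ℕ) < m - n ∧ (q : ℕ) < m - n) * alpha₁ n k + 2 * alpha₂ m k)) •
          vacuum (kappa m n k) := by
  have h₂ : ∀ u ∈ Finset.univ.filter fun u : Fin m => m - n ≤ u.val,
      mode (kappa m n k) (w₁ m n p q) 2 (quadHom (kappa m n k) (e₁₁ m n u j) (e₂₂ m n i u)) = 0 := by
    intro u hu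
    rw [mode_two_quadHom, w₁_lie_e₁₁]
    simp only [map_sub, map_smul, LinearMap.sub_apply, LinearMap.smul_apply,
      kappa_e₁₁_e₂₂ k _ _ _ hi, smul_zero, sub_zero, zero_smul]
  have h₁ : ∀ u ∈ Finset.univ.filter fun u : Fin m => u.val < m - n,
      mode (kappa m n k) (w₁ m n p q) 2 (quadHom (kappa m n k) (e₁₁ m n u j) (e₁₁ m n i u)) =
        delta (q = u) • (delta (p = u) * delta (i = j) * alpha₁ n k) • vacuum (kappa m n k)
          - (delta (q = i) * delta (p = j) * alpha₁ n k) • vacuum (kappa m n k) := by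
    intro u hu
    have hu := (Finset.mem_filter.1 hu).2
    have hiu : i ≠ u := by rintro rfl; omega
    rw [mode_two_quadHom, w₁_lie_e₁₁]
    simp only [map_sub, map_smul, LinearMap.sub_apply, LinearMap.smul_apply, kappa_e₁₁_e₁₁,
      delta_neg hiu, delta_pos True.intro, eq_comm (a := j), smul_eq_mul]
    module
  have hpq' : delta ((p : ℕ) < m - n ∧ (q : ℕ) < m - n) = delta ((q : ℕ) < m - n) := by
    simp only [delta]
    congr 1
    rw [eq_iff_iff]
    omega
  have hα : ((m - n : ℕ) : ℂ) = alpha₂ m k - alpha₁ n k := (alpha₂_sub_alpha₁ k hnm).symm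
  rw [W₁_eq k hnm, nthProduct_stateHom, W₂_eq]
  simp only [map_sub, map_add, map_smul, map_sum]
  rw [Finset.sum_eq_zero h₂, Finset.sum_congr rfl h₁,
    mode_stateHom_eq_zero _ _ _ 2 1 (by norm_num), mode_two_stateHom_two, kappa_w₁_e₁₁,
    Finset.sum_sub_distrib, sum_delta_smul, Finset.sum_const, card_rows_lt,
    ← Nat.cast_smul_eq_nsmul ℂ, hα, hpq']
  module

theorem W₁_of_two_lt_W₂ (hnm : n ≤ m) (p q i j : Fin m) (s : ℤ) (hs : 2 < s) :
    (W₁ m n k p q).nthProduct s (W₂ m n k i j) = 0 := by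
  rw [W₁_eq k hnm, nthProduct_stateHom, W₂_eq]
  simp only [map_sub, map_add, map_smul, map_sum]
  rw [mode_stateHom_eq_zero _ _ _ s 1 (by omega), mode_stateHom_eq_zero _ _ _ s 2 (by omega),
    Finset.sum_eq_zero fun u _ => mode_quadHom_eq_zero _ _ _ _ s hs,
    Finset.sum_eq_zero fun u _ => mode_quadHom_eq_zero _ _ _ _ s hs]
  simp

end WAlgebraGL

end

theorem mainTheorem4 (m n : ℕ) (hnm : n ≤ m) (k : ℂ) (p q i j : Fin m)
    (hpq : (p : ℕ) < m - n ∨ (m - n ≤ (p : ℕ) ∧ m - n ≤ (q : ℕ)))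
    (hi : m - n ≤ (i : ℕ)) :
    (W₁ m n k p q).nthProduct 0 (W₂ m n k i j) =
        -(delta (p = j) • W₂ m n k i q)
        + (delta (i = q) * delta (m - n ≤ (p : ℕ))) • W₂ m n k p j
        - (delta (i = q) * delta ((p : ℕ) < m - n)) •
            ∑ w : Fin m with w.val < m - n, (W₁ m n k w j).nthProduct (-1) (W₁ m n k p w)
        - (delta (i = q) * delta ((p : ℕ) < m - n) * alpha₂ m k) • (W₁ m n k p j).translation
        + delta ((p : ℕ) < m - n ∧ m - n ≤ (q : ℕ)) •
            (W₁ m n k p j).nthProduct (-1) (W₁ m n k i q)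
    ∧ (W₁ m n k p q).nthProduct 1 (W₂ m n k i j) =
        (delta (p = j) * alpha₁ n k * delta (m - n ≤ (q : ℕ))) • W₁ m n k i q
        - (delta (i = q) * delta ((p : ℕ) < m - n) * (alpha₂ m k + alpha₁ n k)) • W₁ m n k p j
        + (delta (p = q) * delta (m - n ≤ (j : ℕ))) • W₁ m n k i j
        - (delta (i = j) * delta ((q : ℕ) < m - n)) • W₁ m n k p q
        + (delta (p = j) * delta (q = i)) • ∑ w : Fin m with w.val < m - n, W₁ m n k w w
    ∧ (W₁ m n k p q).nthProduct 2 (W₂ m n k i j) =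
        (-(delta (q = i) * delta (p = j) * ((alpha₁ n k + alpha₂ m k) * alpha₁ n k))
          - delta (p = q) * delta (i = j) *
            (delta ((p : ℕ) < m - n ∧ (q : ℕ) < m - n) * alpha₁ n k + 2 * alpha₂ m k)) •
          vacuum (kappa m n k)
    ∧ ∀ s : ℤ, 2 < s → (W₁ m n k p q).nthProduct s (W₂ m n k i j) = 0 := by
  have hpq' : m - n ≤ (p : ℕ) → m - n ≤ (q : ℕ) := fun hp =>
    (hpq.resolve_left (not_lt.2 hp)).2
  exact ⟨W₁_zero_W₂ k hnm p q i j hpq' hi, W₁_one_W₂ k hnm p q i j hpq' hi,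
    W₁_two_W₂ k hnm p q i j hpq' hi, W₁_of_two_lt_W₂ k hnm p q i j⟩
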